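/- Let $\mathfrak n$ be a finite-dimensional real nilpotent Lie algebra with a fixed Jordan–Hölder basis $X_1,\dots,X_m$, i.e. a basis with $[\mathfrak n,X_k]\subseteq\operatorname{span}\{X_i : i<k\}$ for all $k$. Let $N=(\mathfrak n,\cdot)$ be the corresponding connected, simply connected nilpotent Lie group, with multiplication given by the Baker–Campbell–Hausdorff formula and coadjoint action $\mathrm{Ad}^*_N(x)\xi=\xi\circ\exp(-\mathrm{ad}\,x)$ for $x\in N$, $\xi\in\mathfrak n^*$. For a nilpotent Lie algebra $\mathfrak h$ with a Jordan–Hölder basis $Y_1,\dots,Y_r$ and $\xi\in\mathfrak h^*$, put $\mathfrak h(\xi)=\{x\in\mathfrak h : [x,\mathfrak h]\subseteq\operatorname{Ker}\xi\}$ and $J(\xi)=\{k : Y_k\notin\operatorname{span}\{Y_i : i<k\}+\mathfrak h(\xi)\}\subseteq\{1,\dots,r\}$. Let $e(\mathfrak h)$ be the minimum of all the sets $J(\xi)$, $\xi\in\mathfrak h^*$, for the total order on subsets of $\{1,\dots,r\}$ given by $e_1\prec e_2\iff\min(e_1\setminus e_2)<\min(e_2\setminus e_1)$, where $\min\emptyset=\infty$.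 One says that $\mathfrak h$ has generic flat coadjoint orbits if $\mathfrak h(\xi)$ equals the center of $\mathfrak h$ for some $\xi\in\mathfrak h^*$. Let $\{0\}=\mathfrak n_0\subseteq\mathfrak n_1\subseteq\cdots\subseteq\mathfrak n_q=\mathfrak n$, where each $\mathfrak n_j$ is spanned by an initial segment $X_1,\dots,X_{d_j}$ of the basis; each ideal $\mathfrak n_j$ carries the Jordan–Hölder basis $X_1,\dots,X_{d_j}$. Assume that for each $j=1,\dots,q$ there are a subalgebra $\mathfrak m_j\subseteq\mathfrak n_j$ and a linear subspace $\mathcal V_j\subseteq\mathfrak m_j$, spanned by the vectors $X_k$ that it contains, such that: - the center $\mathfrak z_j$ of $\mathfrak m_j$ is 1-dimensional, $\mathfrak m_j=\mathfrak z_j\dotplus\mathcal V_j$ (direct sum of vector spaces), $\mathfrak m_j$ has generic flat coadjoint orbits, and $\mathfrak n_j=\mathfrak m_j\ltimes\mathfrak n_{j-1}$, i.e. $\mathfrak n_j=\mathfrak m_j\dotplus\mathfrak n_{j-1}$ with $\mathfrak n_{j-1}$ an ideal of $\mathfrak n_j$; - $[\mathfrak m_j,\mathfrak n_{j-1}]\subseteq\mathcal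 V_1+\cdots+\mathcal V_{j-1}$ and $[\mathfrak m_j,\mathfrak z_1+\cdots+\mathfrak z_{j-1}]=\{0\}$. Let $\mathcal X=\{\xi\in\mathfrak n^* : J(\xi|_{\mathfrak n_j})=e(\mathfrak n_j)\text{ for }j=1,\dots,q\}$ and $\mathfrak s=\mathfrak z_1+\cdots+\mathfrak z_q$. Then: (i) The set $\mathcal X$ is $\mathrm{Ad}^*_N$-invariant. (ii) For every $N$-coadjoint orbit $\mathcal O\subseteq\mathfrak n^*$ one has $\mathcal O\subseteq\mathcal X$ if and only if there exists $\xi\in\mathcal O$ with $\mathfrak n(\xi)=\mathfrak s$ and $\mathcal V_1+\cdots+\mathcal V_q\subseteq\operatorname{Ker}\xi$; and in that case $\xi$ is the unique element of $\mathcal O$ with these two properties. -/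

import Mathlib

noncomputable section

/-- The map `exp (ad x)` on a real Lie algebra `L` (meaningful when `ad x` is nilpotent). -/
def expAd {L : Type*} [LieRing L] [LieAlgebra ℝ L] (x : L) : Module.End ℝ L :=
  letI : Module ℚ L := Module.compHom L (algebraMap ℚ ℝ)
  IsNilpotent.exp (LieAlgebra.ad ℝ L x)

/-- The defining series of `expAd`, with real coefficients. -/
theorem expAd_eq_sum {L : Type*} [LieRing L] [LieAlgebra ℝ L] (x : L) {k : ℕ}
    (h : LieAlgebra.ad ℝ L x ^ k = 0) :
    expAd x = ∑ i ∈ Finset.range k, ((i.factorial : ℝ)⁻¹) • LieAlgebra.ad ℝ L x ^ i := by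
  let _i : Module ℚ L := Module.compHom L (algebraMap ℚ ℝ)
  have e : expAd x = IsNilpotent.exp (LieAlgebra.ad ℝ L x) := rfl
  rw [e, IsNilpotent.exp_eq_sum h]
  refine Finset.sum_congr rfl fun i _ => ?_
  ext y
  change (algebraMap ℚ ℝ ((i.factorial : ℚ)⁻¹)) • ((LieAlgebra.ad ℝ L x ^ i) y) = _
  simp

/-- The coadjoint action `(x, ξ) ↦ ξ ∘ exp (-ad x)` of the simply connected group `N = (L, ·)`,
realized on the set `L` with the Baker–Campbell–Hausdorff product. -/
def coadjoint {L : Type*} [LieRing L] [LieAlgebra ℝ L] (x : L) (ξ : Module.Dual ℝ L) :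
    Module.Dual ℝ L :=
  ξ ∘ₗ expAd (-x)

/-- The coadjoint orbit of `ξ`. -/
def coadjointOrbit {L : Type*} [LieRing L] [LieAlgebra ℝ L] (ξ : Module.Dual ℝ L) :
    Set (Module.Dual ℝ L) :=
  Set.range fun x : L => coadjoint x ξ

/-- The coadjoint isotropy algebra `{x | [x, L] ⊆ Ker ξ}`. -/
def isotropy {L : Type*} [LieRing L] [LieAlgebra ℝ L] (ξ : Module.Dual ℝ L) :
    Submodule ℝ L where
  carrier := {x | ∀ y : L, ξ ⁅x, y⁆ = 0}
  add_mem' := by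
    intro a b ha hb y
    rw [add_lie, map_add, ha y, hb y, add_zero]
  zero_mem' := by
    intro y
    rw [zero_lie, map_zero]
  smul_mem' := by
    intro c x hx y
    rw [smul_lie, map_smul, hx y, smul_zero]

/-- `L` has generic flat coadjoint orbits: some `ξ` has isotropy algebra equal to the center. -/
def HasGenericFlatOrbits (L : Type*) [LieRing L] [LieAlgebra ℝ L] : Prop :=
  ∃ ξ : Module.Dual ℝ L, isotropy ξ = (LieAlgebra.center ℝ L).toSubmodule

/-- A Jordan–Hölder basis `X_1, …, X_m` (indexed from `0` here): `[x, X_j]` lies in the span of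
the `X_i` with `i < j`, for every `x`. -/
structure JordanHolderBasis (L : Type*) [LieRing L] [LieAlgebra ℝ L] (m : ℕ) where
  toBasis : Module.Basis (Fin m) ℝ L
  lie_mem : ∀ (x : L) (j : Fin m),
    ⁅x, toBasis j⁆ ∈ Submodule.span ℝ (toBasis '' {i | i < j})

namespace JordanHolderBasis

/-- The term of dimension `k` of the Jordan–Hölder series: the span of the first `k` basis
vectors, which is an ideal. -/
def ideal {L : Type*} [LieRing L] [LieAlgebra ℝ L] {m : ℕ} (B : JordanHolderBasis L m)
    (k : Fin (m + 1)) : LieIdeal ℝ L where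
  toSubmodule := Submodule.span ℝ (B.toBasis '' {i | (i : ℕ) < (k : ℕ)})
  lie_mem := by
    intro x y hy
    change y ∈ Submodule.span ℝ (B.toBasis '' {i | (i : ℕ) < (k : ℕ)}) at hy
    change ⁅x, y⁆ ∈ Submodule.span ℝ (B.toBasis '' {i | (i : ℕ) < (k : ℕ)})
    induction hy using Submodule.span_induction with
    | mem y hy =>
      obtain ⟨j, hj, rfl⟩ := hy
      refine Submodule.span_mono (Set.image_mono ?_) (B.lie_mem x j)
      intro i hi
      exact lt_trans (Fin.lt_def.1 hi) hj
    | zero => rw [lie_zero]; exact Submodule.zero_mem _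
    | add a b _ _ ha hb => rw [lie_add]; exact Submodule.add_mem _ ha hb
    | smul c a _ ha => rw [lie_smul]; exact Submodule.smul_mem _ c ha

theorem mem_ideal_iff {L : Type*} [LieRing L] [LieAlgebra ℝ L] {m : ℕ}
    (B : JordanHolderBasis L m) (k : Fin (m + 1)) (x : L) :
    x ∈ B.ideal k ↔ x ∈ Submodule.span ℝ (B.toBasis '' {i | (i : ℕ) < (k : ℕ)}) :=
  Iff.rfl

/-- The first `k` basis vectors, as elements of the ideal they span. -/
def restrictVec {L : Type*} [LieRing L] [LieAlgebra ℝ L] {m : ℕ} (B : JordanHolderBasis L m)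
    (k : Fin (m + 1)) (i : Fin (k : ℕ)) : B.ideal k :=
  ⟨B.toBasis (Fin.castLE (Nat.lt_succ_iff.1 k.2) i),
    Submodule.subset_span ⟨_, i.2, rfl⟩⟩

theorem restrictVec_linearIndependent {L : Type*} [LieRing L] [LieAlgebra ℝ L] {m : ℕ}
    (B : JordanHolderBasis L m) (k : Fin (m + 1)) :
    LinearIndependent ℝ (B.restrictVec k) := by
  refine LinearIndependent.of_comp (B.ideal k).toSubmodule.subtype ?_
  exact B.toBasis.linearIndependent.comp _ (Fin.castLE_injective (Nat.lt_succ_iff.1 k.2))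

theorem map_span_restrictVec {L : Type*} [LieRing L] [LieAlgebra ℝ L] {m : ℕ}
    (B : JordanHolderBasis L m) (k : Fin (m + 1)) (n : ℕ) (hn : n ≤ (k : ℕ)) :
    (Submodule.span ℝ (B.restrictVec k '' {i | (i : ℕ) < n})).map
        (B.ideal k).toSubmodule.subtype =
      Submodule.span ℝ (B.toBasis '' {i | (i : ℕ) < n}) := by
  rw [Submodule.map_span, ← Set.image_comp]
  congr 1
  ext v
  constructor
  · rintro ⟨i, hi, rfl⟩
    exact ⟨Fin.castLE (Nat.lt_succ_iff.1 k.2) i, hi, rfl⟩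
  · rintro ⟨i, hi, rfl⟩
    exact ⟨⟨i, lt_of_lt_of_le hi hn⟩, hi, rfl⟩

theorem span_restrictVec {L : Type*} [LieRing L] [LieAlgebra ℝ L] {m : ℕ}
    (B : JordanHolderBasis L m) (k : Fin (m + 1)) :
    ⊤ ≤ Submodule.span ℝ (Set.range (B.restrictVec k)) := by
  intro x _
  have h := B.map_span_restrictVec k k le_rfl
  have hx : (x : L) ∈ Submodule.span ℝ (B.toBasis '' {i | (i : ℕ) < (k : ℕ)}) := x.2
  rw [← h] at hx
  obtain ⟨y, hy, hxy⟩ := hx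
  have : y = x := Subtype.ext hxy
  subst this
  exact Submodule.span_mono (Set.image_subset_range _ _) hy

/-- The Jordan–Hölder basis of the ideal `B.ideal k` formed by the first `k` basis vectors. -/
def restrict {L : Type*} [LieRing L] [LieAlgebra ℝ L] {m : ℕ} (B : JordanHolderBasis L m)
    (k : Fin (m + 1)) : JordanHolderBasis (B.ideal k) (k : ℕ) where
  toBasis := Module.Basis.mk (B.restrictVec_linearIndependent k) (B.span_restrictVec k)
  lie_mem := by
    intro x j
    rw [Module.Basis.coe_mk]
    have h := B.lie_mem (x : L) (Fin.castLE (Nat.lt_succ_iff.1 k.2) j)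
    have e := B.map_span_restrictVec k (j : ℕ) j.2.le
    have h' : ((⁅x, B.restrictVec k j⁆ : B.ideal k) : L) ∈
        Submodule.span ℝ (B.toBasis '' {i | (i : ℕ) < (j : ℕ)}) := h
    rw [← e] at h'
    obtain ⟨y, hy, hxy⟩ := h'
    have : y = ⁅x, B.restrictVec k j⁆ := Subtype.ext hxy
    rw [← this]
    exact hy

open Classical in
/-- The jump set `J(ξ) = {j | X_j ∉ span (X_i : i < j) + L(ξ)}`. -/
def jumpSet {L : Type*} [LieRing L] [LieAlgebra ℝ L] {m : ℕ} (B : JordanHolderBasis L m)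
    (ξ : Module.Dual ℝ L) : Finset (Fin m) :=
  Finset.univ.filter fun j =>
    B.toBasis j ∉ Submodule.span ℝ (B.toBasis '' {i | i < j}) ⊔ isotropy ξ

end JordanHolderBasis

/-- The ordering of index sets: `e₁ ≺ e₂` iff `min (e₁ \ e₂) < min (e₂ \ e₁)`, where
`min ∅ = ∞`. -/
def JumpPrec {m : ℕ} (e₁ e₂ : Finset (Fin m)) : Prop :=
  (e₁ \ e₂).min < (e₂ \ e₁).min

/-- `≺` is the lexicographic order on the indicator functions of the complements. -/
theorem jumpPrec_iff_lex {m : ℕ} (e₁ e₂ : Finset (Fin m)) :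
    JumpPrec e₁ e₂ ↔
      toLex (fun i => decide (i ∉ e₁)) < toLex (fun i => decide (i ∉ e₂)) := by
  constructor
  · intro h
    obtain ⟨i, hi⟩ := WithTop.ne_top_iff_exists.1 (ne_top_of_lt h)
    have hi' := Finset.mem_sdiff.1 (Finset.mem_of_min hi.symm)
    refine ⟨i, fun j hj => ?_, ?_⟩
    · have h1 : j ∉ e₁ \ e₂ := fun hm =>
        absurd (Finset.min_le_of_eq hm hi.symm) (not_le.2 hj)
      have h2 : j ∉ e₂ \ e₁ := by
        intro hm
        have := lt_of_lt_of_le h (Finset.min_le hm)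
        rw [← hi, WithTop.coe_lt_coe] at this
        exact lt_asymm this hj
      rw [Finset.mem_sdiff] at h1 h2
      have : j ∈ e₁ ↔ j ∈ e₂ := by tauto
      simp [this]
    · simp [hi'.1, hi'.2]
  · rintro ⟨i, hlt, hi⟩
    have hi' : i ∈ e₁ ∧ i ∉ e₂ := by
      have hb := Bool.lt_iff.1 hi
      simpa using hb
    refine lt_of_le_of_lt (Finset.min_le (Finset.mem_sdiff.2 hi')) ?_
    rcases hmin : (e₂ \ e₁).min with _ | j
    · exact WithTop.coe_lt_top i
    have hj := Finset.mem_sdiff.1 (Finset.mem_of_min hmin)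
    refine WithTop.coe_lt_coe.2 ?_
    by_contra hij
    rcases lt_or_eq_of_le (not_lt.1 hij) with h | h
    · have := hlt j h
      simp [hj.1, hj.2] at this
    · rw [h] at hj
      exact hj.2 hi'.1

theorem JordanHolderBasis.exists_min_jumpSet {L : Type*} [LieRing L] [LieAlgebra ℝ L] {m : ℕ}
    (B : JordanHolderBasis L m) :
    ∃ e : Finset (Fin m), (∃ ξ, B.jumpSet ξ = e) ∧
      ∀ η, e = B.jumpSet η ∨ JumpPrec e (B.jumpSet η) := by
  obtain ⟨e, ⟨ξ, rfl⟩, h⟩ := (Set.toFinite (Set.range B.jumpSet)).exists_minimalFor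
    (fun e : Finset (Fin m) => toLex (fun i => decide (i ∉ e))) _ (Set.range_nonempty _)
  refine ⟨_, ⟨ξ, rfl⟩, fun η => ?_⟩
  rcases lt_trichotomy (toLex (fun i => decide (i ∉ B.jumpSet ξ)))
    (toLex (fun i => decide (i ∉ B.jumpSet η))) with h1 | h1 | h1
  · exact Or.inr ((jumpPrec_iff_lex _ _).2 h1)
  · left
    ext i
    have := congrFun (toLex_inj.1 h1) i
    simpa [not_iff_not] using this
  · exact absurd (h ⟨η, rfl⟩ h1.le) (not_le.2 h1)

/-- The generic jump set `e(L)`: the `≺`-minimum of all jump sets of functionals on `L`. -/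
def JordanHolderBasis.genericJumpSet {L : Type*} [LieRing L] [LieAlgebra ℝ L] {m : ℕ}
    (B : JordanHolderBasis L m) : Finset (Fin m) :=
  B.exists_min_jumpSet.choose

theorem JordanHolderBasis.genericJumpSet_spec {L : Type*} [LieRing L] [LieAlgebra ℝ L] {m : ℕ}
    (B : JordanHolderBasis L m) :
    (∃ ξ, B.jumpSet ξ = B.genericJumpSet) ∧
      ∀ η, B.genericJumpSet = B.jumpSet η ∨ JumpPrec B.genericJumpSet (B.jumpSet η) :=
  B.exists_min_jumpSet.choose_spec

/-- `V` is compatible with the basis: the basis vectors lying in `V` form a basis of `V`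
(they are automatically linearly independent). -/
def JordanHolderBasis.Compatible {L : Type*} [LieRing L] [LieAlgebra ℝ L] {m : ℕ}
    (B : JordanHolderBasis L m) (V : Submodule ℝ L) : Prop :=
  Submodule.span ℝ ((V : Set L) ∩ Set.range B.toBasis) = V

/-- The center of a subalgebra `M`, as a linear subspace of the ambient Lie algebra. -/
def centerOf {L : Type*} [LieRing L] [LieAlgebra ℝ L] (M : LieSubalgebra ℝ L) :
    Submodule ℝ L :=
  (LieAlgebra.center ℝ M).toSubmodule.map M.toSubmodule.subtype

/-- The internal semidirect product decomposition `T = M ⋉ I`: `M` is a subalgebra of `T`, `I` is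
an ideal of `T`, and `T` is the vector space direct sum of `M` and `I`. -/
structure IsSemidirect {L : Type*} [LieRing L] [LieAlgebra ℝ L]
    (T M I : LieSubalgebra ℝ L) : Prop where
  lie_mem : ∀ x ∈ T, ∀ y ∈ I, ⁅x, y⁆ ∈ I
  disjoint : Disjoint M.toSubmodule I.toSubmodule
  sup_eq : M.toSubmodule ⊔ I.toSubmodule = T.toSubmodule

/-- The set of all `ξ` whose restriction to each of the ideals `B.ideal (d j)`, `1 ≤ j ≤ q`, has
the generic jump set of that ideal. -/
def stepwiseGenericSet {L : Type*} [LieRing L] [LieAlgebra ℝ L] {m q : ℕ}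
    (B : JordanHolderBasis L m) (d : Fin (q + 1) → Fin (m + 1)) : Set (Module.Dual ℝ L) :=
  {ξ | ∀ j : Fin q,
    (B.restrict (d j.succ)).jumpSet (ξ ∘ₗ (B.ideal (d j.succ)).toSubmodule.subtype) =
      (B.restrict (d j.succ)).genericJumpSet}

end

/-!
Write `N j` for the ideals of the chain, `Z j` for the center of `M j`, and `rad_W ξ` for the radical
of the form `(x, y) ↦ ξ [x, y]` on a subspace `W`.

*Normal forms.* If `ξ` vanishes on `V i` for all `i < j`, then `M j` and `N j` are orthogonal for the
form of `ξ`, because `[M j, N j]` lies in the sum of these `V i`; so the radical on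
`N (j + 1) = M j + N j` is the sum of the radicals on `M j` and on `N j`
(`IsFlatTower.radicalOn_succ`). Call `ξ` a normal form if it vanishes on every `V j` and
`rad_{M j} ξ = Z j` for every `j`. For `ξ` vanishing on every `V j`, the second condition is
equivalent to `L(ξ) = Z 0 + ⋯ + Z (q - 1)`.

*Generic orbits contain normal forms.* A functional with generic jump set has a minimal isotropy
algebra (`JordanHolderBasis.jumpSet_ne_genericJumpSet`). Going up the tower, suppose that `ξ` vanishes
on `V i` for `i < j`. If `rad_{M j} ξ` were larger than `Z j`, then `ξ` would vanish on `Z j`, and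
making it nonzero there would shrink the radical on `N (j + 1)`
(`IsFlatTower.exists_radicalOn_lt`). Hence the orbit of `ξ` restricted to `M j` is flat, it consists
of all functionals with the same restriction to `Z j` (`exists_coadjoint_eq_add`), and some `x` in
`M j` moves `ξ` to a functional which vanishes on `V j`. As `[x, N j]` lies in the sum of the earlier
`V i`, nothing changes on `N j`.

*Normal forms are generic.* All normal forms have the same radicals on the `N j`, hence the same jump
sets. Having a generic jump set is a nonempty Zariski open condition
(`JordanHolderBasis.finite_setOf_jumpSet_add_smul_ne`), so the stepwise generic set is nonempty; it is
invariant under the coadjoint action, so it contains the normal form of one of its elements, and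
therefore every normal form.

*Uniqueness.* If the action of `z` takes a normal form `ξ` to a normal form which agrees with `ξ` on
`N j`, then `ξ [z, N j] = 0` (`apply_lie_eq_zero_of_apply_expAd`), so that `z` is a sum of an element
of `rad_{N j} ξ = ∑ i < j, Z i` and of elements of `M i` with `i ≥ j`. All of these commute with
`Z j`, so the two normal forms agree on `Z j` too, and thus on `N (j + 1)`
(`IsFlatTower.coadjoint_eq_of_normal_form`).

Orbits are defined with single exponentials, so composing coadjoint actions needs the part of the
Baker–Campbell–Hausdorff formula which says that `exp (ad x) exp (ad y) = exp (ad z)` for some `z`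
(`exists_expAd_eq_mul`). Let `Z` be a polynomial curve in `L` with `Z(0) = x` and
`((1 - exp (-ad Z)) / ad Z) Z' = y`, which exists by Picard iteration along the lower central series.
By the formula for the derivative of the exponential (`derivation_mul_realExp`), the operator
`exp (ad Z(t)) exp (-t ad y)` is constant in `t`, and comparing its values at `0` and `1` gives
`z = Z(1)`.
-/

open scoped TensorProduct

attribute [local instance] LieRing.ofAssociativeRing

/-! ### Exponentials of nilpotent elements -/

/-- The exponential of a nilpotent element of a real algebra. -/
noncomputable def realExp {A : Type*} [Ring A] [Algebra ℝ A] (a : A) : A :=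
  letI : Module ℚ A := Module.compHom A (algebraMap ℚ ℝ)
  IsNilpotent.exp a

section RealExp

variable {A : Type*} [Ring A] [Algebra ℝ A]

theorem realExp_eq_sum {a : A} {k : ℕ} (h : a ^ k = 0) :
    realExp a = ∑ i ∈ Finset.range k, ((i.factorial : ℝ)⁻¹) • a ^ i := by
  let _i : Module ℚ A := Module.compHom A (algebraMap ℚ ℝ)
  have e : realExp a = IsNilpotent.exp a := rfl
  rw [e, IsNilpotent.exp_eq_sum h]
  refine Finset.sum_congr rfl fun i _ => ?_
  change (algebraMap ℚ ℝ ((i.factorial : ℚ)⁻¹)) • a ^ i = _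
  simp

theorem realExp_add_of_commute {a b : A} (h : Commute a b) (ha : IsNilpotent a)
    (hb : IsNilpotent b) : realExp (a + b) = realExp a * realExp b := by
  let _i : Module ℚ A := Module.compHom A (algebraMap ℚ ℝ)
  have : SMulCommClass ℚ A A := ⟨fun q x y => mul_smul_comm (algebraMap ℚ ℝ q) x y |>.symm⟩
  have : IsScalarTower ℚ A A := ⟨fun q x y => smul_mul_assoc (algebraMap ℚ ℝ q) x y⟩
  exact IsNilpotent.exp_add_of_commute h ha hb

theorem realExp_zero : realExp (0 : A) = 1 := by
  rw [realExp_eq_sum (k := 1) (pow_one _)]; simp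

theorem realExp_mul_realExp_neg {a : A} (ha : IsNilpotent a) :
    realExp a * realExp (-a) = 1 := by
  rw [← realExp_add_of_commute (Commute.refl a).neg_right ha ha.neg, add_neg_cancel, realExp_zero]

theorem realExp_neg_mul_realExp {a : A} (ha : IsNilpotent a) :
    realExp (-a) * realExp a = 1 := by
  rw [← realExp_add_of_commute (Commute.refl a).neg_left ha.neg ha, neg_add_cancel, realExp_zero]

/-- On a vector killed by the `k`-th power of a nilpotent operator, only the first `k` terms of the
exponential series matter. -/
theorem realExp_apply_eq_sum {E : Type*} [AddCommGroup E] [Module ℝ E] {a : Module.End ℝ E}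
    (ha : IsNilpotent a) {v : E} {k : ℕ} (h : (a ^ k) v = 0) :
    realExp a v = ∑ i ∈ Finset.range k, ((i.factorial : ℝ)⁻¹) • (a ^ i) v := by
  obtain ⟨n, hn⟩ := ha
  have hz : ∀ i, k ≤ i → (a ^ i) v = 0 := fun i hi => by
    rw [← Nat.sub_add_cancel hi, pow_add, Module.End.mul_apply, h, map_zero]
  rw [realExp_eq_sum (k := max n k) (pow_eq_zero_of_le (le_max_left _ _) hn),
    LinearMap.sum_apply]
  refine (Finset.sum_subset (Finset.range_mono (le_max_right n k)) fun i _ hi => ?_).symm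
  rw [LinearMap.smul_apply, hz i (by simpa using hi), smul_zero]

theorem isNilpotent_neg_ad {a : A} (ha : IsNilpotent a) :
    IsNilpotent (-(LieAlgebra.ad ℝ A a)) :=
  (LieAlgebra.ad_nilpotent_of_nilpotent ha).neg

/-- `exp (-a) D exp a = exp (-ad a) D`, for a nilpotent element `a` of an associative algebra. -/
theorem mul_realExp {a : A} (ha : IsNilpotent a) (D : A) :
    D * realExp a = realExp a * realExp (-(LieAlgebra.ad ℝ A a)) D := by
  have hl : IsNilpotent (LinearMap.mulLeft ℝ a) := (LinearMap.isNilpotent_mulLeft_iff ℝ a).2 ha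
  have hr : IsNilpotent (LinearMap.mulRight ℝ a) := (LinearMap.isNilpotent_mulRight_iff ℝ a).2 ha
  have had : LieAlgebra.ad ℝ A a = LinearMap.mulLeft ℝ a - LinearMap.mulRight ℝ a := by
    ext x; simp [Ring.lie_def]
  have hc : Commute (LinearMap.mulLeft ℝ a) (LinearMap.mulRight ℝ a) :=
    LinearMap.commute_mulLeft_right (R := ℝ) a a
  have hsum : LinearMap.mulRight ℝ a = LinearMap.mulLeft ℝ a + -(LieAlgebra.ad ℝ A a) := by
    rw [had]; abel
  have hcomm : Commute (LinearMap.mulLeft ℝ a) (-(LieAlgebra.ad ℝ A a)) := by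
    rw [had]; exact ((Commute.refl _).sub_right hc).neg_right
  have key := realExp_add_of_commute hcomm hl (isNilpotent_neg_ad ha)
  rw [← hsum] at key
  obtain ⟨n, hn⟩ := ha
  have h1 : realExp (LinearMap.mulRight ℝ a) = LinearMap.mulRight ℝ (realExp a) := by
    rw [realExp_eq_sum (k := n) (by rw [LinearMap.pow_mulRight, hn, LinearMap.mulRight_zero_eq_zero]),
      realExp_eq_sum hn]
    ext x
    simp [LinearMap.pow_mulRight, Finset.mul_sum]
  have h2 : realExp (LinearMap.mulLeft ℝ a) = LinearMap.mulLeft ℝ (realExp a) := by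
    rw [realExp_eq_sum (k := n) (by rw [LinearMap.pow_mulLeft, hn, LinearMap.mulLeft_zero_eq_zero]),
      realExp_eq_sum hn]
    ext x
    simp [LinearMap.pow_mulLeft, Finset.sum_mul]
  rw [h1, h2] at key
  simpa using LinearMap.congr_fun key D

end RealExp

/-! ### The derivative of the exponential of an inner derivation -/

section ExpAd

variable {L : Type*} [LieRing L] [LieAlgebra ℝ L]

theorem expAd_eq_realExp {x : L} (hx : IsNilpotent (LieAlgebra.ad ℝ L x)) :
    expAd x = realExp (LieAlgebra.ad ℝ L x) := by
  obtain ⟨n, hn⟩ := hx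
  rw [expAd_eq_sum x hn, realExp_eq_sum hn]

/-- `dexpSeries n Z Y` is `∑_{i < n} (-1)^i / (i+1)! (ad Z)^i Y`, a truncation of
`((1 - exp (-ad Z)) / ad Z) Y`, which governs the derivative of the exponential. -/
noncomputable def dexpSeries (n : ℕ) (Z Y : L) : L :=
  ∑ i ∈ Finset.range n, ((-1 : ℝ) ^ i * ((i + 1).factorial : ℝ)⁻¹) • (LieAlgebra.ad ℝ L Z ^ i) Y

theorem neg_ad_pow_succ_derivation {Z : L} {D : Module.End ℝ L}
    (hD : ∀ x y, D ⁅x, y⁆ = ⁅D x, y⁆ + ⁅x, D y⁆) (k : ℕ) :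
    ((-(LieAlgebra.ad ℝ (Module.End ℝ L) (LieAlgebra.ad ℝ L Z))) ^ (k + 1)) D =
      (-1 : ℝ) ^ k • LieAlgebra.ad ℝ L ((LieAlgebra.ad ℝ L Z ^ k) (D Z)) := by
  induction k with
  | zero =>
    ext y
    simp [Ring.lie_def, hD]
  | succ k ih =>
    rw [pow_succ', Module.End.mul_apply, ih, pow_succ' (LieAlgebra.ad ℝ L Z), Module.End.mul_apply]
    rw [LinearMap.neg_apply, map_smul, LieAlgebra.ad_apply (R := ℝ) (L := Module.End ℝ L),
      ← LieHom.map_lie, pow_succ', mul_smul, neg_one_smul, LieAlgebra.ad_apply]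

/-- The derivative of the exponential: `exp (-ad Z) D exp (ad Z) = D + ad (dexpSeries Z (D Z))`
for a derivation `D`. -/
theorem derivation_mul_realExp {n : ℕ} {Z : L} (hZ : LieAlgebra.ad ℝ L Z ^ n = 0)
    {D : Module.End ℝ L} (hD : ∀ x y, D ⁅x, y⁆ = ⁅D x, y⁆ + ⁅x, D y⁆) :
    D * realExp (LieAlgebra.ad ℝ L Z) =
      realExp (LieAlgebra.ad ℝ L Z) * (D + LieAlgebra.ad ℝ L (dexpSeries n Z (D Z))) := by
  rw [mul_realExp ⟨n, hZ⟩]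
  congr 1
  rw [realExp_apply_eq_sum (isNilpotent_neg_ad ⟨n, hZ⟩) (k := n + 1)
    (by rw [neg_ad_pow_succ_derivation hD, hZ]; simp), Finset.sum_range_succ', add_comm]
  congr 1
  · simp
  · simp only [dexpSeries, map_sum, neg_ad_pow_succ_derivation hD, map_smul, smul_smul]
    exact Finset.sum_congr rfl fun i _ => by rw [mul_comm]

theorem realExp_ad_lie {Z : L} (hZ : IsNilpotent (LieAlgebra.ad ℝ L Z)) (u v : L) :
    realExp (LieAlgebra.ad ℝ L Z) ⁅u, v⁆ =
      ⁅realExp (LieAlgebra.ad ℝ L Z) u, realExp (LieAlgebra.ad ℝ L Z) v⁆ := by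
  set a := LieAlgebra.ad ℝ L Z with ha
  have hpow : ∀ (w : L) (k : ℕ), ((-(LieAlgebra.ad ℝ (Module.End ℝ L) a)) ^ k)
      (LieAlgebra.ad ℝ L w) = LieAlgebra.ad ℝ L (((-a) ^ k) w) := by
    intro w k
    induction k with
    | zero => simp
    | succ k ih =>
      rw [pow_succ', Module.End.mul_apply, ih, pow_succ' (-a), Module.End.mul_apply,
        LinearMap.neg_apply, LieAlgebra.ad_apply (R := ℝ) (L := Module.End ℝ L), ha,
        ← LieHom.map_lie, LinearMap.neg_apply, map_neg, LieAlgebra.ad_apply]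
  have hexp : ∀ w : L, realExp (-(LieAlgebra.ad ℝ (Module.End ℝ L) a)) (LieAlgebra.ad ℝ L w) =
      LieAlgebra.ad ℝ L (realExp (-a) w) := by
    intro w
    obtain ⟨n, hn⟩ := hZ
    have hn' : (-a) ^ n = 0 := by rw [neg_pow, hn, mul_zero]
    rw [realExp_apply_eq_sum (isNilpotent_neg_ad ⟨n, hn⟩) (k := n)
      (by rw [hpow, hn']; simp), realExp_eq_sum hn']
    simp [hpow]
  have h := LinearMap.congr_fun
    (mul_realExp hZ (LieAlgebra.ad ℝ L (realExp a u))) v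
  rw [hexp, ← Module.End.mul_apply (realExp (-a)), realExp_neg_mul_realExp hZ] at h
  simpa using h.symm

end ExpAd

/-! ### Solving the differential equation of the exponential -/

section Picard

variable {L : Type*} [LieRing L] [LieAlgebra ℝ L]

theorem dexpSeries_sub (n : ℕ) (Z Y Y' : L) :
    dexpSeries n Z (Y - Y') = dexpSeries n Z Y - dexpSeries n Z Y' := by
  simp [dexpSeries, smul_sub]

/-- The differential equation `dexpSeries Z Z' = Y` can be solved to any order along a central
filtration `F`, by Picard iteration: replacing `Z` by `Z - I r`, with `r` the current error and `I`
an antiderivative, pushes the error one step further down. -/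
theorem exists_dexpSeries_sub_mem {F : ℕ → Submodule ℝ L} (hF_zero : F 0 = ⊤)
    (hF_le : ∀ k, F (k + 1) ≤ F k) (hF_lie : ∀ k, ∀ x : L, ∀ y ∈ F k, ⁅x, y⁆ ∈ F (k + 1))
    {D I : Module.End ℝ L} (hDI : ∀ x, D (I x) = x) (hI : ∀ k, ∀ x ∈ F k, I x ∈ F k)
    (n : ℕ) (Z₀ Y : L) (k : ℕ) :
    ∃ W, dexpSeries (n + 1) (Z₀ + I W) (D (Z₀ + I W)) - Y ∈ F k := by
  induction k with
  | zero => exact ⟨0, by simp [hF_zero]⟩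
  | succ k ih =>
    obtain ⟨W, hW⟩ := ih
    set Z := Z₀ + I W with hZ
    set r := dexpSeries (n + 1) Z (D Z) - Y with hr
    have hZ' : Z₀ + I (W - r) = Z - I r := by rw [hZ, map_sub]; abel
    refine ⟨W - r, ?_⟩
    have hpow : ∀ (Y : L) (i : ℕ), (LieAlgebra.ad ℝ L (Z - I r) ^ i) Y -
        (LieAlgebra.ad ℝ L Z ^ i) Y ∈ F (k + 1) := by
      intro Y i
      induction i with
      | zero => simp
      | succ i ih =>
        have e : (LieAlgebra.ad ℝ L (Z - I r) ^ (i + 1)) Y - (LieAlgebra.ad ℝ L Z ^ (i + 1)) Y =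
            ⁅(LieAlgebra.ad ℝ L (Z - I r) ^ i) Y, I r⁆ +
              ⁅Z, (LieAlgebra.ad ℝ L (Z - I r) ^ i) Y - (LieAlgebra.ad ℝ L Z ^ i) Y⁆ := by
          rw [pow_succ', pow_succ', Module.End.mul_apply, Module.End.mul_apply,
            LieAlgebra.ad_apply, LieAlgebra.ad_apply, sub_lie, lie_sub,
            ← lie_skew (I r)]
          abel
        rw [e]
        exact add_mem (hF_lie k _ _ (hI k _ hW)) (hF_le _ (hF_lie _ _ _ ih))
    have hdiff : dexpSeries (n + 1) (Z - I r) (D Z) - dexpSeries (n + 1) Z (D Z) ∈ F (k + 1) := by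
      rw [dexpSeries, dexpSeries, ← Finset.sum_sub_distrib]
      refine sum_mem fun i _ => ?_
      rw [← smul_sub]
      exact Submodule.smul_mem _ _ (hpow _ _)
    have hlead : dexpSeries (n + 1) (Z - I r) r - r ∈ F (k + 1) := by
      rw [dexpSeries, Finset.sum_range_succ']
      simp only [pow_zero, zero_add, Nat.factorial_one, Nat.cast_one, inv_one, mul_one, one_smul,
        Module.End.one_apply, add_sub_cancel_right]
      refine sum_mem fun i hi => Submodule.smul_mem _ _ ?_
      clear hi
      rw [pow_succ', Module.End.mul_apply, LieAlgebra.ad_apply]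
      refine hF_lie k _ _ ?_
      clear hdiff hpow
      induction i with
      | zero => simpa using hW
      | succ i ih =>
        rw [pow_succ', Module.End.mul_apply, LieAlgebra.ad_apply]
        exact hF_le _ (hF_lie k _ _ ih)
    have e : dexpSeries (n + 1) (Z - I r) (D (Z - I r)) - Y =
        (dexpSeries (n + 1) (Z - I r) (D Z) - dexpSeries (n + 1) Z (D Z)) -
          (dexpSeries (n + 1) (Z - I r) r - r) := by
      have hDr : D (Z - I r) = D Z - r := by rw [map_sub, hDI]
      have hr' : dexpSeries (n + 1) Z (D Z) = r + Y := by rw [hr]; abel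
      rw [hDr, dexpSeries_sub, hr']
      abel
    rw [hZ', e]
    exact sub_mem hdiff hlead

end Picard

/-! ### Polynomial curves and the group of inner automorphisms -/

section PolynomialCurves

open Polynomial

/-- The antiderivative of a polynomial vanishing at `0`. -/
noncomputable def polyAntideriv : ℝ[X] →ₗ[ℝ] ℝ[X] :=
  Polynomial.lsum fun n => ((n + 1 : ℝ)⁻¹) • Polynomial.monomial (n + 1)

theorem polyAntideriv_monomial (n : ℕ) (a : ℝ) :
    polyAntideriv (monomial n a) = monomial (n + 1) ((n + 1 : ℝ)⁻¹ * a) := by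
  simp [polyAntideriv, Polynomial.lsum_apply, Polynomial.smul_monomial]

theorem derivative_polyAntideriv (p : ℝ[X]) : derivative (polyAntideriv p) = p := by
  induction p using Polynomial.induction_on' with
  | add p q hp hq => rw [map_add, map_add, hp, hq]
  | monomial n a =>
    rw [polyAntideriv_monomial, derivative_monomial]
    have : (n + 1 : ℝ) ≠ 0 := by positivity
    congr 1
    push_cast
    field_simp

theorem eval_zero_polyAntideriv (p : ℝ[X]) : (polyAntideriv p).eval 0 = 0 := by
  induction p using Polynomial.induction_on' with
  | add p q hp hq => rw [map_add, eval_add, hp, hq, add_zero]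
  | monomial n a => simp [polyAntideriv_monomial]

theorem polyAntideriv_derivative (p : ℝ[X]) :
    C (p.eval 0) + polyAntideriv (derivative p) = p := by
  induction p using Polynomial.induction_on' with
  | add p q hp hq =>
    rw [eval_add, map_add, map_add, map_add]
    nth_rewrite 3 [← hp]
    nth_rewrite 3 [← hq]
    abel
  | monomial n a =>
    rcases n with _ | n
    · simp
    · rw [derivative_monomial, Nat.add_sub_cancel, polyAntideriv_monomial]
      have : (n + 1 : ℝ) ≠ 0 := by positivity
      simp only [eval_monomial, ne_eq, Nat.add_eq_zero_iff, one_ne_zero, and_false,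
        not_false_eq_true, zero_pow, mul_zero, map_zero, zero_add, Nat.cast_add, Nat.cast_one]
      congr 1
      field_simp

variable {L : Type*} [LieRing L] [LieAlgebra ℝ L]

/-- Evaluation at `s` of a polynomial curve with values in `L`. -/
noncomputable def evalCurve (L : Type*) [LieRing L] [LieAlgebra ℝ L] (s : ℝ) :
    ℝ[X] ⊗[ℝ] L →ₗ[ℝ] L :=
  (TensorProduct.lid ℝ L).toLinearMap ∘ₗ LinearMap.rTensor L (Polynomial.leval s)

@[simp]
theorem evalCurve_tmul (s : ℝ) (p : ℝ[X]) (x : L) : evalCurve L s (p ⊗ₜ x) = p.eval s • x := by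
  simp [evalCurve]

theorem evalCurve_lie (s : ℝ) (x y : ℝ[X] ⊗[ℝ] L) :
    evalCurve L s ⁅x, y⁆ = ⁅evalCurve L s x, evalCurve L s y⁆ := by
  induction x using TensorProduct.induction_on with
  | zero => rw [zero_lie y, map_zero, zero_lie]
  | add x x' hx hx' => rw [add_lie x x' y, map_add, map_add, add_lie, hx, hx']
  | tmul p u =>
    induction y using TensorProduct.induction_on with
    | zero => rw [lie_zero (p ⊗ₜ[ℝ] u), map_zero, lie_zero]
    | add y y' hy hy' => rw [lie_add (p ⊗ₜ[ℝ] u) y y', map_add, map_add, lie_add, hy, hy']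
    | tmul r v => simp [smul_smul, mul_comm]

theorem evalCurve_ad_pow (s : ℝ) (Z x : ℝ[X] ⊗[ℝ] L) (i : ℕ) :
    evalCurve L s ((LieAlgebra.ad ℝ _ Z ^ i) x) =
      (LieAlgebra.ad ℝ L (evalCurve L s Z) ^ i) (evalCurve L s x) := by
  induction i with
  | zero => simp
  | succ i ih =>
    rw [pow_succ', pow_succ', Module.End.mul_apply, Module.End.mul_apply, LieAlgebra.ad_apply,
      LieAlgebra.ad_apply, evalCurve_lie, ih]

theorem evalCurve_realExp {n : ℕ} (hn : ∀ x : L, LieAlgebra.ad ℝ L x ^ n = 0)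
    (hn' : ∀ x : ℝ[X] ⊗[ℝ] L, LieAlgebra.ad ℝ _ x ^ n = 0) (s : ℝ) (Z x : ℝ[X] ⊗[ℝ] L) :
    evalCurve L s (realExp (LieAlgebra.ad ℝ _ Z) x) =
      expAd (evalCurve L s Z) (evalCurve L s x) := by
  rw [expAd_eq_sum _ (hn _), realExp_eq_sum (hn' Z), LinearMap.sum_apply, LinearMap.sum_apply,
    map_sum]
  exact Finset.sum_congr rfl fun i _ => by
    rw [LinearMap.smul_apply, LinearMap.smul_apply, map_smul, evalCurve_ad_pow]

/-- Differentiation of polynomial curves. -/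
noncomputable def curveDeriv (L : Type*) [LieRing L] [LieAlgebra ℝ L] :
    Module.End ℝ (ℝ[X] ⊗[ℝ] L) :=
  LinearMap.rTensor L Polynomial.derivative

/-- The antiderivative of a polynomial curve vanishing at `0`. -/
noncomputable def curveAntideriv (L : Type*) [LieRing L] [LieAlgebra ℝ L] :
    Module.End ℝ (ℝ[X] ⊗[ℝ] L) :=
  LinearMap.rTensor L polyAntideriv

theorem curveDeriv_lie (x y : ℝ[X] ⊗[ℝ] L) :
    curveDeriv L ⁅x, y⁆ = ⁅curveDeriv L x, y⁆ + ⁅x, curveDeriv L y⁆ := by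
  induction x using TensorProduct.induction_on with
  | zero => rw [zero_lie y, map_zero, zero_lie y, zero_lie (curveDeriv L y), add_zero]
  | add x x' hx hx' =>
    rw [add_lie x x' y, map_add, map_add, hx, hx', add_lie _ _ y, add_lie x x' (curveDeriv L y)]
    abel
  | tmul p u =>
    induction y using TensorProduct.induction_on with
    | zero => rw [map_zero, lie_zero (p ⊗ₜ[ℝ] u), map_zero, lie_zero (curveDeriv L _), add_zero]
    | add y y' hy hy' =>
      rw [lie_add (p ⊗ₜ[ℝ] u) y y', map_add, map_add, hy, hy', lie_add (curveDeriv L _) y y',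
        lie_add (p ⊗ₜ[ℝ] u)]
      abel
    | tmul r v => simp [curveDeriv, TensorProduct.add_tmul]

theorem curveDeriv_curveAntideriv (x : ℝ[X] ⊗[ℝ] L) :
    curveDeriv L (curveAntideriv L x) = x := by
  induction x using TensorProduct.induction_on with
  | zero => simp
  | add x y hx hy => rw [map_add, map_add, hx, hy]
  | tmul p u => simp [curveDeriv, curveAntideriv, derivative_polyAntideriv]

theorem evalCurve_zero_curveAntideriv (x : ℝ[X] ⊗[ℝ] L) :
    evalCurve L 0 (curveAntideriv L x) = 0 := by
  induction x using TensorProduct.induction_on with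
  | zero => simp
  | add x y hx hy => rw [map_add, map_add, hx, hy, add_zero]
  | tmul p u => simp [curveAntideriv, eval_zero_polyAntideriv]

theorem evalCurve_add_curveAntideriv_curveDeriv (x : ℝ[X] ⊗[ℝ] L) :
    1 ⊗ₜ evalCurve L 0 x + curveAntideriv L (curveDeriv L x) = x := by
  induction x using TensorProduct.induction_on with
  | zero => simp
  | add x y hx hy =>
    simp only [map_add, TensorProduct.tmul_add]
    nth_rewrite 3 [← hx]
    nth_rewrite 3 [← hy]
    abel
  | tmul p u =>
    simp only [evalCurve_tmul, curveAntideriv, curveDeriv, LinearMap.rTensor_tmul]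
    rw [← TensorProduct.smul_tmul, ← TensorProduct.add_tmul]
    congr 1
    nth_rewrite 3 [← polyAntideriv_derivative p]
    rw [Polynomial.smul_eq_C_mul, mul_one]

theorem evalCurve_eq_of_curveDeriv_eq_zero {x : ℝ[X] ⊗[ℝ] L} (hx : curveDeriv L x = 0) (s : ℝ) :
    evalCurve L s x = evalCurve L 0 x := by
  rw [← evalCurve_add_curveAntideriv_curveDeriv x, hx]
  simp

/-- Polynomial curves with values in the `k`-th term of the lower central series. -/
noncomputable def curveFiltration (L : Type*) [LieRing L] [LieAlgebra ℝ L] (k : ℕ) :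
    Submodule ℝ (ℝ[X] ⊗[ℝ] L) :=
  LinearMap.range (LinearMap.lTensor ℝ[X]
    (LieModule.lowerCentralSeries ℝ L L k).toSubmodule.subtype)

theorem tmul_mem_curveFiltration {k : ℕ} (p : ℝ[X]) {u : L}
    (hu : u ∈ LieModule.lowerCentralSeries ℝ L L k) : p ⊗ₜ u ∈ curveFiltration L k :=
  ⟨p ⊗ₜ ⟨u, hu⟩, by simp⟩

theorem curveFiltration_le_iff {k : ℕ} {F : Submodule ℝ (ℝ[X] ⊗[ℝ] L)} :
    curveFiltration L k ≤ F ↔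
      ∀ (p : ℝ[X]), ∀ u ∈ LieModule.lowerCentralSeries ℝ L L k, p ⊗ₜ u ∈ F := by
  refine ⟨fun h p u hu => h (tmul_mem_curveFiltration p hu), ?_⟩
  rintro h _ ⟨w, rfl⟩
  induction w using TensorProduct.induction_on with
  | zero => simp
  | add x y hx hy => rw [map_add]; exact add_mem hx hy
  | tmul p u => exact h p u u.2

theorem curveFiltration_lie (k : ℕ) (x y : ℝ[X] ⊗[ℝ] L) (hy : y ∈ curveFiltration L k) :
    ⁅x, y⁆ ∈ curveFiltration L (k + 1) := by
  induction x using TensorProduct.induction_on with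
  | zero => rw [zero_lie y]; exact zero_mem _
  | add x x' hx hx' => rw [add_lie x x' y]; exact add_mem hx hx'
  | tmul p u =>
    have h : curveFiltration L k ≤
        (curveFiltration L (k + 1)).comap (LieAlgebra.ad ℝ _ (p ⊗ₜ[ℝ] u)) := by
      rw [curveFiltration_le_iff]
      intro r v hv
      rw [Submodule.mem_comap, LieAlgebra.ad_apply, LieAlgebra.ExtendScalars.bracket_tmul]
      refine tmul_mem_curveFiltration _ ?_
      rw [LieModule.lowerCentralSeries_succ]
      exact LieSubmodule.lie_mem_lie (LieSubmodule.mem_top u) hv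
    exact h hy

/-- **Existence part of the Baker–Campbell–Hausdorff formula**: in a nilpotent Lie algebra the
exponentials of the inner derivations form a group. -/
theorem exists_expAd_eq_mul [LieRing.IsNilpotent L] (x y : L) :
    ∃ z : L, expAd z = expAd x * expAd y := by
  obtain ⟨n₁, h₁⟩ := LieModule.exists_forall_pow_toEnd_eq_zero ℝ L L
  obtain ⟨n₂, h₂⟩ := LieModule.exists_forall_pow_toEnd_eq_zero ℝ[X] (ℝ[X] ⊗[ℝ] L) (ℝ[X] ⊗[ℝ] L)
  obtain ⟨c, hc⟩ := LieModule.IsNilpotent.nilpotent ℝ L L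
  set n := max n₁ n₂ with hn_def
  have hn₁ : ∀ x : L, LieAlgebra.ad ℝ L x ^ (n + 1) = 0 := fun x =>
    pow_eq_zero_of_le (by omega) (h₁ x)
  have hn₂ : ∀ x : ℝ[X] ⊗[ℝ] L, LieAlgebra.ad ℝ _ x ^ (n + 1) = 0 := by
    intro x
    refine pow_eq_zero_of_le (m := n₂) (by omega) ?_
    refine LinearMap.ext fun w => ?_
    have hw := LinearMap.congr_fun (h₂ x) w
    rw [Module.End.pow_apply] at hw
    rw [Module.End.pow_apply]
    exact hw
  obtain ⟨W, hW⟩ := exists_dexpSeries_sub_mem (F := curveFiltration L)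
    (by
      rw [eq_top_iff]
      intro w _
      induction w using TensorProduct.induction_on with
      | zero => exact zero_mem _
      | add x y hx hy => exact add_mem (hx trivial) (hy trivial)
      | tmul p u => exact tmul_mem_curveFiltration p (by simp))
    (fun k => curveFiltration_le_iff.2 fun p u hu => tmul_mem_curveFiltration p
      (LieModule.antitone_lowerCentralSeries ℝ L L k.le_succ hu))
    curveFiltration_lie (curveDeriv_curveAntideriv (L := L))
    (fun k => by
      change curveFiltration L k ≤ (curveFiltration L k).comap (curveAntideriv L)
      rw [curveFiltration_le_iff]
      intro p u hu
      exact tmul_mem_curveFiltration (polyAntideriv p) hu)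
    n (1 ⊗ₜ x) (1 ⊗ₜ y) c
  have hbot : curveFiltration L c ≤ ⊥ := by
    rw [curveFiltration_le_iff]
    intro p u hu
    rw [hc, LieSubmodule.mem_bot] at hu
    simp [hu]
  have hZ := sub_eq_zero.1 ((Submodule.mem_bot ℝ).1 (hbot hW))
  set Z : ℝ[X] ⊗[ℝ] L := 1 ⊗ₜ x + curveAntideriv L W with hZdef
  have hZ0 : evalCurve L 0 Z = x := by simp [hZdef, evalCurve_zero_curveAntideriv]
  -- The curve `t ↦ -t y`, along which the second factor `exp (-t ad y)` moves.
  set T : ℝ[X] ⊗[ℝ] L := X ⊗ₜ (-y) with hT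
  have hDT : curveDeriv L T = -(1 ⊗ₜ y) := by simp [hT, curveDeriv, TensorProduct.tmul_neg]
  have hTy : ⁅T, (1 : ℝ[X]) ⊗ₜ[ℝ] y⁆ = 0 := by simp [hT]
  have hser : dexpSeries (n + 1) T (curveDeriv L T) = -(1 ⊗ₜ y) := by
    rw [hDT, dexpSeries, Finset.sum_range_succ', Finset.sum_eq_zero]
    · simp
    · intro i _
      rw [pow_succ (LieAlgebra.ad ℝ _ T), Module.End.mul_apply, LieAlgebra.ad_apply,
        lie_neg T, hTy]
      simp
  have hcommTy : Commute (LieAlgebra.ad ℝ (ℝ[X] ⊗[ℝ] L) (1 ⊗ₜ y))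
      (realExp (LieAlgebra.ad ℝ (ℝ[X] ⊗[ℝ] L) T)) := by
    have h0 : Commute (LieAlgebra.ad ℝ (ℝ[X] ⊗[ℝ] L) (1 ⊗ₜ y))
        (LieAlgebra.ad ℝ (ℝ[X] ⊗[ℝ] L) T) := by
      rw [commute_iff_lie_eq, ← LieHom.map_lie, ← lie_skew, hTy, neg_zero, map_zero]
    rw [realExp_eq_sum (hn₂ T)]
    exact Commute.sum_right _ _ _ fun i _ => (h0.pow_right i).smul_right _
  have e₁ := derivation_mul_realExp (hn₂ Z) (curveDeriv_lie (L := L))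
  have e₂ := derivation_mul_realExp (hn₂ T) (curveDeriv_lie (L := L))
  rw [hZ] at e₁
  rw [hser, map_neg] at e₂
  set E := realExp (LieAlgebra.ad ℝ (ℝ[X] ⊗[ℝ] L) Z) * realExp (LieAlgebra.ad ℝ (ℝ[X] ⊗[ℝ] L) T)
    with hE
  have hDE : curveDeriv L * E = E * curveDeriv L := by
    rw [hE, ← mul_assoc, e₁, mul_assoc, add_mul, e₂, hcommTy.eq, ← mul_add,
      neg_add_cancel_right, mul_assoc]
  refine ⟨evalCurve L 1 Z, ?_⟩
  have hconst : ∀ u : L, expAd (evalCurve L 1 Z) (expAd (-y) u) = expAd x u := by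
    intro u
    have hD : curveDeriv L (E (1 ⊗ₜ u)) = 0 := by
      change (curveDeriv L * E) (1 ⊗ₜ u) = 0
      rw [hDE]
      change E (curveDeriv L (1 ⊗ₜ u)) = 0
      simp [curveDeriv]
    have h := evalCurve_eq_of_curveDeriv_eq_zero hD 1
    rw [hE, Module.End.mul_apply, evalCurve_realExp hn₁ hn₂, evalCurve_realExp hn₁ hn₂,
      evalCurve_realExp hn₁ hn₂, evalCurve_realExp hn₁ hn₂, hZ0] at h
    have h0 : expAd (0 : L) = 1 := by
      rw [expAd_eq_sum (k := 1) _ (by simp)]; simp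
    simpa [hT, h0] using h
  ext u
  rw [Module.End.mul_apply, ← hconst (expAd y u), ← Module.End.mul_apply (expAd (-y)),
    expAd_eq_realExp ⟨_, hn₁ (-y)⟩, expAd_eq_realExp ⟨_, hn₁ y⟩, map_neg,
    realExp_neg_mul_realExp ⟨_, hn₁ y⟩, Module.End.one_apply]

end PolynomialCurves

/-! ### The coadjoint action and flat orbits -/

section Coadjoint

variable {L : Type*} [LieRing L] [LieAlgebra ℝ L]

theorem isNilpotent_ad [LieRing.IsNilpotent L] (x : L) : IsNilpotent (LieAlgebra.ad ℝ L x) := by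
  obtain ⟨k, hk⟩ := LieModule.exists_forall_pow_toEnd_eq_zero ℝ L L
  exact ⟨k, hk x⟩

theorem coadjoint_apply (x : L) (ξ : Module.Dual ℝ L) (y : L) :
    coadjoint x ξ y = ξ (expAd (-x) y) := rfl

theorem mem_isotropy_iff {ξ : Module.Dual ℝ L} {x : L} :
    x ∈ isotropy ξ ↔ ∀ y, ξ ⁅x, y⁆ = 0 := Iff.rfl

theorem isotropy_smul {c : ℝ} (hc : c ≠ 0) (ξ : Module.Dual ℝ L) :
    isotropy (c • ξ) = isotropy ξ := by
  ext u
  simp [mem_isotropy_iff, hc]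

theorem mem_center_iff_lie_eq_zero {x : L} :
    x ∈ (LieAlgebra.center ℝ L).toSubmodule ↔ ∀ y : L, ⁅x, y⁆ = 0 := by
  change x ∈ LieModule.maxTrivSubmodule ℝ L L ↔ _
  rw [LieModule.mem_maxTrivSubmodule]
  refine forall_congr' fun y => ?_
  rw [← lie_skew, neg_eq_zero]

theorem center_le_isotropy (ξ : Module.Dual ℝ L) :
    (LieAlgebra.center ℝ L).toSubmodule ≤ isotropy ξ := fun x hx y => by
  rw [mem_center_iff_lie_eq_zero.1 hx, map_zero]

/-- The functional `y ↦ ξ [x, y]`, as a linear map in `x`; its kernel is the isotropy algebra. -/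
def lieForm : Module.Dual ℝ L →ₗ[ℝ] L →ₗ[ℝ] Module.Dual ℝ L :=
  LinearMap.mk₂ ℝ (fun ξ x => ξ ∘ₗ LieAlgebra.ad ℝ L x)
    (fun _ _ _ => rfl) (fun _ _ _ => rfl)
    (fun ξ x y => by ext; simp) (fun c ξ x => by ext; simp)

theorem ker_lieForm (ξ : Module.Dual ℝ L) : LinearMap.ker (lieForm ξ) = isotropy ξ := by
  ext x
  rw [LinearMap.mem_ker, mem_isotropy_iff, LinearMap.ext_iff]
  rfl

/-- By nondegeneracy of the induced form on `L / L(η)`, any functional vanishing on `L(η)` has the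
form `y ↦ η [y, x]`. -/
theorem exists_eq_apply_lie [FiniteDimensional ℝ L] {η ζ : Module.Dual ℝ L}
    (h : isotropy η ≤ LinearMap.ker ζ) : ∃ x, ∀ y, ζ y = η ⁅y, x⁆ := by
  have hζ : ζ ∈ LinearMap.range (lieForm η).dualMap := by
    rw [LinearMap.range_dualMap_eq_dualAnnihilator_ker, ker_lieForm, Submodule.mem_dualAnnihilator]
    exact fun w hw => h hw
  obtain ⟨φ, rfl⟩ := hζ
  refine ⟨(Module.evalEquiv ℝ L).symm φ, fun y => ?_⟩
  rw [LinearMap.dualMap_apply]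
  conv_lhs => rw [← (Module.evalEquiv ℝ L).apply_symm_apply φ]
  rfl

variable [LieRing.IsNilpotent L]

theorem expAd_expAd_neg (x y : L) : expAd x (expAd (-x) y) = y := by
  rw [expAd_eq_realExp (isNilpotent_ad x), expAd_eq_realExp (isNilpotent_ad (-x)), map_neg,
    ← Module.End.mul_apply, realExp_mul_realExp_neg (isNilpotent_ad x), Module.End.one_apply]

theorem expAd_neg_expAd (x y : L) : expAd (-x) (expAd x y) = y := by
  simpa using expAd_expAd_neg (-x) y

theorem expAd_lie (x u v : L) : expAd x ⁅u, v⁆ = ⁅expAd x u, expAd x v⁆ := by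
  rw [expAd_eq_realExp (isNilpotent_ad x), realExp_ad_lie (isNilpotent_ad x)]

/-- Second order expansion of `exp (ad x) y`, modulo an `ad x`-invariant subspace. -/
theorem expAd_sub_sub_mem {W : Submodule ℝ L} {x y : L} (hW : ∀ w ∈ W, ⁅x, w⁆ ∈ W)
    (hy : ⁅x, ⁅x, y⁆⁆ ∈ W) : expAd x y - y - ⁅x, y⁆ ∈ W := by
  obtain ⟨n, hn⟩ := isNilpotent_ad x
  have hpow : ∀ i, (LieAlgebra.ad ℝ L x ^ (i + 2)) y ∈ W := by
    intro i
    induction i with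
    | zero => simpa [pow_two] using hy
    | succ i ih =>
      rw [show i + 1 + 2 = (i + 2) + 1 by ring, pow_succ', Module.End.mul_apply]
      exact hW _ ih
  have e : expAd x y - y - ⁅x, y⁆ = ∑ i ∈ Finset.range n,
      (((i + 2).factorial : ℝ)⁻¹) • (LieAlgebra.ad ℝ L x ^ (i + 2)) y := by
    rw [expAd_eq_sum x (k := n + 2) (pow_eq_zero_of_le (by omega) hn), LinearMap.sum_apply,
      Finset.sum_range_succ', Finset.sum_range_succ']
    simp
  rw [e]
  exact sum_mem fun i _ => W.smul_mem _ (hpow i)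

theorem expAd_sub_mem {W : Submodule ℝ L} {x y : L} (hW : ∀ w ∈ W, ⁅x, w⁆ ∈ W)
    (hy : ⁅x, y⁆ ∈ W) : expAd x y - y ∈ W := by
  have h := add_mem (expAd_sub_sub_mem hW (hW _ hy)) hy
  rwa [sub_add_cancel] at h

theorem expAd_eq_self {x y : L} (h : ⁅x, y⁆ = 0) : expAd x y = y := by
  have := expAd_sub_mem (W := ⊥) (x := x) (y := y) (by simp) (by simpa using h)
  simpa [sub_eq_zero] using this

theorem expAd_mem {W : Submodule ℝ L} {x y : L} (hW : ∀ w ∈ W, ⁅x, w⁆ ∈ W) (hy : y ∈ W) :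
    expAd x y ∈ W := by
  have h := add_mem (expAd_sub_mem hW (hW _ hy)) hy
  rwa [sub_add_cancel] at h

/-- The stabilizer of a functional is the exponential of its infinitesimal stabilizer, on any
`ad x`-invariant subspace. -/
theorem apply_lie_eq_zero_of_apply_expAd {W : Submodule ℝ L} {x : L} {ξ : Module.Dual ℝ L}
    (hW : ∀ w ∈ W, ⁅x, w⁆ ∈ W) (h : ∀ w ∈ W, ξ (expAd x w) = ξ w) :
    ∀ w ∈ W, ξ ⁅x, w⁆ = 0 := by
  obtain ⟨n, hn⟩ := isNilpotent_ad x
  have hWpow : ∀ (i : ℕ), ∀ w ∈ W, (LieAlgebra.ad ℝ L x ^ i) w ∈ W := by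
    intro i w hw
    induction i with
    | zero => simpa using hw
    | succ i ih => rw [pow_succ', Module.End.mul_apply]; exact hW _ ih
  -- Descending induction on the power of `ad x`.
  have key : ∀ k, k ≤ n → ∀ w ∈ W, ξ ((LieAlgebra.ad ℝ L x ^ (n - k + 1)) w) = 0 := by
    intro k
    induction k with
    | zero => intro _ w _; rw [Nat.sub_zero, pow_succ, hn]; simp
    | succ k ih =>
      intro hk w hw
      obtain ⟨j, hj⟩ : ∃ j, n - k = j + 1 := ⟨n - k - 1, by omega⟩
      have hj' : n - (k + 1) = j := by omega
      have ih' := ih (by omega)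
      rw [hj] at ih'
      rw [hj']
      set v := (LieAlgebra.ad ℝ L x ^ j) w with hv
      have hmem := expAd_sub_sub_mem (x := x) (y := v)
        (W := W.map (LieAlgebra.ad ℝ L x ^ (j + 1 + 1)))
        (by
          rintro _ ⟨u, hu, rfl⟩
          refine ⟨⁅x, u⁆, hW u hu, ?_⟩
          rw [← LieAlgebra.ad_apply ℝ, ← LieAlgebra.ad_apply ℝ, ← Module.End.mul_apply,
            ← Module.End.mul_apply, ← pow_succ, ← pow_succ'])
        ⟨w, hw, by rw [pow_succ', pow_succ', Module.End.mul_apply, Module.End.mul_apply]; rfl⟩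
      obtain ⟨u, hu, hu'⟩ := hmem
      have h0 := ih' u hu
      rw [hu', map_sub, map_sub, h v (hWpow j w hw), sub_self, zero_sub, neg_eq_zero] at h0
      rw [pow_succ', Module.End.mul_apply]
      exact h0
  intro w hw
  have := key n le_rfl w hw
  simpa using this

theorem coadjoint_zero (ξ : Module.Dual ℝ L) : coadjoint 0 ξ = ξ := by
  ext y
  rw [coadjoint_apply, neg_zero, expAd_eq_self (zero_lie y)]

theorem coadjoint_neg_coadjoint (x : L) (ξ : Module.Dual ℝ L) :
    coadjoint (-x) (coadjoint x ξ) = ξ := by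
  ext y
  rw [coadjoint_apply, coadjoint_apply, neg_neg, expAd_neg_expAd]

theorem exists_coadjoint_coadjoint (x y : L) (ξ : Module.Dual ℝ L) :
    ∃ z, coadjoint z ξ = coadjoint x (coadjoint y ξ) := by
  obtain ⟨z, hz⟩ := exists_expAd_eq_mul (-y) (-x)
  refine ⟨-z, ?_⟩
  ext u
  rw [coadjoint_apply, neg_neg, hz]
  rfl

theorem isotropy_coadjoint (x : L) (ξ : Module.Dual ℝ L) :
    isotropy (coadjoint x ξ) = (isotropy ξ).comap (expAd (-x)) := by
  ext u
  simp only [Submodule.mem_comap, mem_isotropy_iff, coadjoint_apply, expAd_lie]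
  constructor
  · intro h y
    simpa [expAd_neg_expAd] using h (expAd x y)
  · intro h y
    exact h _

theorem isotropy_coadjoint_eq_center {η : Module.Dual ℝ L}
    (h : isotropy η = (LieAlgebra.center ℝ L).toSubmodule) (x : L) :
    isotropy (coadjoint x η) = (LieAlgebra.center ℝ L).toSubmodule := by
  refine le_antisymm (fun u hu => ?_) (center_le_isotropy _)
  rw [isotropy_coadjoint, Submodule.mem_comap, h] at hu
  have e : expAd x (expAd (-x) u) = expAd (-x) u := expAd_eq_self (by
    rw [← lie_skew, mem_center_iff_lie_eq_zero.1 hu, neg_zero])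
  rw [expAd_expAd_neg] at e
  rwa [e]

/-- If the isotropy algebra of `η` is the center, then the coadjoint orbit of `η` is the whole
affine space of functionals which agree with `η` on the center. -/
theorem exists_coadjoint_eq_add [FiniteDimensional ℝ L] {η ζ : Module.Dual ℝ L}
    (hη : isotropy η = (LieAlgebra.center ℝ L).toSubmodule)
    (hζ : (LieAlgebra.center ℝ L).toSubmodule ≤ LinearMap.ker ζ) :
    ∃ x, coadjoint x η = η + ζ := by
  -- The correction `ζ` is removed step by step along the lower central series.
  have key : ∀ (k : ℕ) (η ζ : Module.Dual ℝ L),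
      isotropy η = (LieAlgebra.center ℝ L).toSubmodule →
      (LieAlgebra.center ℝ L).toSubmodule ≤ LinearMap.ker ζ →
      (LieModule.lowerCentralSeries ℝ L L k).toSubmodule ≤ LinearMap.ker ζ →
      ∃ x, coadjoint x η = η + ζ := by
    intro k
    induction k with
    | zero =>
      intro η ζ _ _ h
      refine ⟨0, ?_⟩
      have h0 : ζ = 0 := by ext y; exact h (by simp)
      rw [coadjoint_zero, h0, add_zero]
    | succ k ih =>
      intro η ζ hη hζ h
      obtain ⟨x, hx⟩ := exists_eq_apply_lie (hη ▸ hζ)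
      set η₁ := coadjoint x η with hη₁
      have hlie : ∀ (u : L), ∀ y ∈ LieModule.lowerCentralSeries ℝ L L k,
          ⁅u, y⁆ ∈ LieModule.lowerCentralSeries ℝ L L (k + 1) := fun u y hy => by
        rw [LieModule.lowerCentralSeries_succ]
        exact LieSubmodule.lie_mem_lie (LieSubmodule.mem_top u) hy
      obtain ⟨x₁, hx₁⟩ := ih η₁ (η + ζ - η₁) (isotropy_coadjoint_eq_center hη x)
        (fun y hy => by
          have h1 : η₁ y = η y := by
            rw [hη₁, coadjoint_apply, expAd_eq_self]
            rw [← lie_skew, mem_center_iff_lie_eq_zero.1 hy, neg_zero]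
          have h2 : ζ y = 0 := hζ hy
          simp [h1, h2])
        (fun y hy => by
          have hmem := expAd_sub_sub_mem (x := -x) (y := y)
            (W := (LieModule.lowerCentralSeries ℝ L L (k + 1)).toSubmodule.map
              (LieAlgebra.ad ℝ L (-x)))
            (by
              rintro _ ⟨u, hu, rfl⟩
              exact ⟨⁅-x, u⁆, LieSubmodule.lie_mem _ hu, rfl⟩)
            ⟨⁅-x, y⁆, hlie _ _ hy, rfl⟩
          obtain ⟨u, hu, hu'⟩ := hmem
          have h0 : η ⁅-x, u⁆ = 0 := by
            rw [neg_lie, lie_skew, ← hx u]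
            exact h hu
          rw [← LieAlgebra.ad_apply ℝ, hu', map_sub, map_sub, ← coadjoint_apply, ← hη₁, neg_lie,
            lie_skew, ← hx y] at h0
          rw [LinearMap.mem_ker, LinearMap.sub_apply, LinearMap.add_apply]
          linarith)
      obtain ⟨z, hz⟩ := exists_coadjoint_coadjoint x₁ x η
      refine ⟨z, ?_⟩
      rw [hz, ← hη₁, hx₁]
      abel
  obtain ⟨c, hc⟩ := LieModule.IsNilpotent.nilpotent ℝ L L
  exact key c η ζ hη hζ (by rw [hc]; simp)

/-- In a nilpotent Lie algebra with one-dimensional center and generic flat coadjoint orbits, the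
orbits of all functionals not vanishing on the center are flat. -/
theorem isotropy_eq_center_of_apply_ne_zero [FiniteDimensional ℝ L]
    (hdim : Module.finrank ℝ (LieAlgebra.center ℝ L).toSubmodule = 1)
    (hflat : HasGenericFlatOrbits L) {η : Module.Dual ℝ L} {c : L}
    (hc : c ∈ (LieAlgebra.center ℝ L).toSubmodule) (hηc : η c ≠ 0) :
    isotropy η = (LieAlgebra.center ℝ L).toSubmodule := by
  obtain ⟨η₀, hη₀⟩ := hflat
  have hspan : ∀ y ∈ (LieAlgebra.center ℝ L).toSubmodule, ∃ t : ℝ, y = t • c := by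
    intro y hy
    have hc0 : (⟨c, hc⟩ : (LieAlgebra.center ℝ L).toSubmodule) ≠ 0 := by
      intro h
      have : c = 0 := congrArg Subtype.val h
      rw [this, map_zero] at hηc
      exact hηc rfl
    obtain ⟨t, ht⟩ := (finrank_eq_one_iff_of_nonzero' _ hc0).1 hdim ⟨y, hy⟩
    exact ⟨t, (congrArg Subtype.val ht).symm⟩
  by_cases h0 : η₀ c = 0
  · -- Here `0` lies in the flat orbit of `η₀`, which forces the Lie algebra to be abelian.
    obtain ⟨x, hx⟩ := exists_coadjoint_eq_add hη₀ (ζ := -η₀) (fun y hy => by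
      obtain ⟨t, rfl⟩ := hspan y hy
      simp [h0])
    have htop := isotropy_coadjoint_eq_center hη₀ x
    rw [hx, add_neg_cancel] at htop
    refine le_antisymm (fun u _ => ?_) (center_le_isotropy _)
    rw [← htop, mem_isotropy_iff]
    simp
  · have ht : η c / η₀ c ≠ 0 := div_ne_zero hηc h0
    have hη₁ := hη₀
    rw [← isotropy_smul ht] at hη₁
    obtain ⟨x, hx⟩ := exists_coadjoint_eq_add hη₁ (ζ := η - (η c / η₀ c) • η₀) (fun y hy => by
      obtain ⟨t, rfl⟩ := hspan y hy
      simp [h0])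
    rw [add_sub_cancel] at hx
    rw [← hx]
    exact isotropy_coadjoint_eq_center hη₁ x

end Coadjoint

/-! ### Pivots and linear independence along lines -/

section LinearAlgebra

variable {E : Type*} [AddCommGroup E] [Module ℝ E]

/-- Linear independence is an open condition along lines, in the Zariski sense. -/
theorem finite_setOf_not_linearIndependent_add_smul {ι : Type*} [Finite ι]
    {a : ι → E} (ha : LinearIndependent ℝ a) (b : ι → E) :
    {t : ℝ | ¬ LinearIndependent ℝ (fun i => a i + t • b i)}.Finite := by
  classical
  cases nonempty_fintype ι
  obtain ⟨f, hf⟩ := LinearMap.exists_leftInverse_of_injective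
    (Fintype.linearCombination ℝ a) (linearIndependent_iff_injective_fintypeLinearCombination.1 ha |>
      LinearMap.ker_eq_bot.2)
  have hfa : ∀ i, f (a i) = Pi.single i 1 := fun i => by
    have := LinearMap.congr_fun hf (Pi.single i 1)
    simpa [Fintype.linearCombination_apply_single] using this
  let Q : Matrix ι ι (Polynomial ℝ) := Matrix.of fun i j =>
    Polynomial.C (f (a i) j) + Polynomial.X * Polynomial.C (f (b i) j)
  have hQ : ∀ t, Q.det.eval t = (Matrix.of fun i => f (a i + t • b i)).det := by
    intro t
    rw [← Polynomial.coe_evalRingHom, RingHom.map_det]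
    congr 1
    ext i j
    simp [Q]
    ring
  have hQ0 : Q.det ≠ 0 := by
    intro h
    have h0 := hQ 0
    rw [h, Polynomial.eval_zero] at h0
    have h1 : (Matrix.of fun i => f (a i + (0 : ℝ) • b i)) = (1 : Matrix ι ι ℝ) := by
      ext i j
      simp [hfa, Matrix.one_apply, Pi.single_apply, eq_comm]
    rw [h1, Matrix.det_one] at h0
    exact zero_ne_one h0
  refine (Polynomial.finite_setOfPred_isRoot hQ0).subset fun t ht => ?_
  by_contra hroot
  refine ht ?_
  rw [Set.mem_ofPred_eq, Polynomial.IsRoot.def, hQ] at hroot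
  have h1 : LinearIndependent ℝ (fun i => f (a i + t • b i)) :=
    Matrix.linearIndependent_rows_of_det_ne_zero hroot
  exact LinearIndependent.of_comp f h1

/-- The vectors not in the span of their predecessors span the same flag as the whole family. -/
theorem span_image_lt_le_span_pivots {m : ℕ} (v : Fin m → E) (k : Fin m) :
    Submodule.span ℝ (v '' {i | i < k}) ≤
      Submodule.span ℝ (v '' {i | i < k ∧ v i ∉ Submodule.span ℝ (v '' {j | j < i})}) := by
  induction k using WellFoundedLT.induction with
  | ind k ih =>
    rw [Submodule.span_le]
    rintro _ ⟨i, hi, rfl⟩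
    by_cases h : v i ∈ Submodule.span ℝ (v '' {j | j < i})
    · refine Submodule.span_mono (Set.image_mono ?_) (ih i hi h)
      exact fun j hj => ⟨lt_trans hj.1 hi, hj.2⟩
    · exact Submodule.subset_span ⟨i, ⟨hi, h⟩, rfl⟩

theorem linearIndepOn_pivots {m : ℕ} (v : Fin m → E) :
    LinearIndepOn ℝ v {i | v i ∉ Submodule.span ℝ (v '' {j | j < i})} := by
  have key : ∀ n : ℕ, LinearIndepOn ℝ v
      {i | (i : ℕ) < n ∧ v i ∉ Submodule.span ℝ (v '' {j | j < i})} := by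
    intro n
    induction n with
    | zero => simp
    | succ n ih =>
      by_cases h : ∃ k : Fin m, (k : ℕ) = n ∧ v k ∉ Submodule.span ℝ (v '' {j | j < k})
      · obtain ⟨k, rfl, hk⟩ := h
        refine (ih.insert (x := k) fun hmem => hk ?_).mono ?_
        · exact Submodule.span_mono (Set.image_mono fun j hj => hj.1) hmem
        · intro i hi
          rcases Nat.lt_succ_iff_lt_or_eq.1 hi.1 with h | h
          · exact Or.inr ⟨h, hi.2⟩
          · exact Or.inl (Fin.ext h)
      · refine ih.mono fun i hi => ⟨?_, hi.2⟩
        rcases Nat.lt_succ_iff_lt_or_eq.1 hi.1 with h' | h'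
        · exact h'
        · exact absurd ⟨i, h', hi.2⟩ h
  refine (key m).mono fun i hi => ⟨i.2, hi⟩

end LinearAlgebra

/-! ### Jump sets of functionals -/

section JumpSets

variable {L : Type*} [LieRing L] [LieAlgebra ℝ L] {m : ℕ}

namespace JordanHolderBasis

variable (B : JordanHolderBasis L m)

theorem mem_jumpSet_iff {ξ : Module.Dual ℝ L} {j : Fin m} : j ∈ B.jumpSet ξ ↔
    B.toBasis j ∉ Submodule.span ℝ (B.toBasis '' {i | i < j}) ⊔ isotropy ξ := by
  simp [jumpSet]

theorem mem_jumpSet_iff_lieForm {ξ : Module.Dual ℝ L} {j : Fin m} : j ∈ B.jumpSet ξ ↔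
    lieForm ξ (B.toBasis j) ∉
      Submodule.span ℝ ((fun i => lieForm ξ (B.toBasis i)) '' {i | i < j}) := by
  rw [mem_jumpSet_iff, not_iff_not, ← ker_lieForm, ← Submodule.comap_map_eq,
    Submodule.mem_comap, Submodule.map_span, ← Set.image_comp]
  rfl

theorem jumpSet_smul {c : ℝ} (hc : c ≠ 0) (ξ : Module.Dual ℝ L) :
    B.jumpSet (c • ξ) = B.jumpSet ξ := by
  ext j
  rw [mem_jumpSet_iff, mem_jumpSet_iff, isotropy_smul hc]

theorem isotropy_le_of_jumpSet_subset {ξ ξ' : Module.Dual ℝ L} (hle : isotropy ξ' ≤ isotropy ξ)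
    (hJ : B.jumpSet ξ' ⊆ B.jumpSet ξ) : isotropy ξ ≤ isotropy ξ' := by
  have key : ∀ n, n ≤ m → ∀ x ∈ isotropy ξ,
      x ∈ Submodule.span ℝ (B.toBasis '' {i | (i : ℕ) < n}) → x ∈ isotropy ξ' := by
    intro n
    induction n with
    | zero =>
      intro _ x _ hx
      have : x = 0 := by simpa using hx
      rw [this]; exact zero_mem _
    | succ n ih =>
      intro hn x hx hxs
      have hset : {i : Fin m | (i : ℕ) < n + 1} = insert ⟨n, hn⟩ {i : Fin m | (i : ℕ) < n} := by
        ext i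
        simp only [Set.mem_ofPred_eq, Set.mem_insert_iff, Fin.ext_iff]
        omega
      rw [hset, Set.image_insert_eq, Submodule.mem_span_insert] at hxs
      obtain ⟨c, z, hz, rfl⟩ := hxs
      by_cases hc : c = 0
      · subst hc
        rw [zero_smul, zero_add] at hx ⊢
        exact ih (by omega) z hx hz
      · have h1 : (⟨n, hn⟩ : Fin m) ∉ B.jumpSet ξ := by
          rw [mem_jumpSet_iff, not_not]
          have e : B.toBasis ⟨n, hn⟩ =
              -(c⁻¹ • z) + c⁻¹ • (c • B.toBasis ⟨n, hn⟩ + z) := by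
            rw [smul_add, smul_smul, inv_mul_cancel₀ hc, one_smul]; abel
          rw [e]
          exact Submodule.add_mem_sup (neg_mem (Submodule.smul_mem _ _ hz))
            (Submodule.smul_mem _ _ hx)
        have h2 : (⟨n, hn⟩ : Fin m) ∉ B.jumpSet ξ' := fun h => h1 (hJ h)
        rw [mem_jumpSet_iff, not_not] at h2
        obtain ⟨u, hu, r, hr, hur⟩ := Submodule.mem_sup.1 h2
        have e : c • B.toBasis ⟨n, hn⟩ + z = (c • u + z) + c • r := by
          rw [← hur, smul_add]; abel
        rw [e] at hx ⊢
        have hcr := Submodule.smul_mem _ c hr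
        refine add_mem (ih (by omega) _ ?_ ?_) hcr
        · have := sub_mem hx (hle hcr)
          rwa [add_sub_cancel_right] at this
        · exact add_mem (Submodule.smul_mem _ _ hu) hz
  intro x hx
  refine key m le_rfl x hx ?_
  have hset : {i : Fin m | (i : ℕ) < m} = Set.univ := by ext i; simp
  rw [hset, Set.image_univ, B.toBasis.span_eq]
  trivial

/-- A functional with generic jump set has a minimal isotropy algebra. -/
theorem jumpSet_ne_genericJumpSet {ξ ξ' : Module.Dual ℝ L} (h : isotropy ξ' < isotropy ξ) :
    B.jumpSet ξ ≠ B.genericJumpSet := by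
  intro hgen
  have hsub : B.jumpSet ξ ⊆ B.jumpSet ξ' := by
    intro j hj
    rw [mem_jumpSet_iff] at hj ⊢
    exact fun hmem => hj (sup_le_sup_left h.le _ hmem)
  rcases B.genericJumpSet_spec.2 ξ' with he | hlt
  · exact h.not_ge (B.isotropy_le_of_jumpSet_subset h.le (he.symm.trans hgen.symm).subset)
  · rw [← hgen, JumpPrec, Finset.sdiff_eq_empty_iff_subset.2 hsub, Finset.min_empty] at hlt
    exact not_top_lt hlt

/-- Having the generic jump set is an open condition along lines, in the Zariski sense. -/
theorem finite_setOf_jumpSet_add_smul_ne {ξ : Module.Dual ℝ L}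
    (hξ : B.jumpSet ξ = B.genericJumpSet) (η : Module.Dual ℝ L) :
    {t : ℝ | B.jumpSet (ξ + t • η) ≠ B.genericJumpSet}.Finite := by
  let v : Module.Dual ℝ L → Fin m → Module.Dual ℝ L := fun ξ i => lieForm ξ (B.toBasis i)
  have hmem : ∀ ξ j, j ∈ B.jumpSet ξ ↔ v ξ j ∉ Submodule.span ℝ (v ξ '' {i | i < j}) :=
    fun ξ j => B.mem_jumpSet_iff_lieForm
  have hli : LinearIndependent ℝ fun i : (B.genericJumpSet : Set (Fin m)) => v ξ i := by
    refine (linearIndepOn_pivots (v ξ)).mono fun i hi => ?_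
    rw [← hξ] at hi
    exact (hmem ξ i).1 hi
  refine (finite_setOf_not_linearIndependent_add_smul hli fun i => v η i).subset
    fun t ht hli' => ht ?_
  have hlin : LinearIndepOn ℝ (v (ξ + t • η)) (B.genericJumpSet : Set (Fin m)) := by
    have e : (fun i : (B.genericJumpSet : Set (Fin m)) => v ξ i + t • v η i) =
        fun i : (B.genericJumpSet : Set (Fin m)) => v (ξ + t • η) i := by
      funext i
      simp [v]
    rw [e] at hli'
    exact hli'
  rcases B.genericJumpSet_spec.2 (ξ + t • η) with he | hlt
  · exact he.symm
  -- At the first index `k` where the jump sets differ, the `k`-th vector would depend on the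
  -- previous generic pivots.
  exfalso
  obtain ⟨k, hk⟩ := WithTop.ne_top_iff_exists.1 (ne_top_of_lt hlt)
  have hk' := Finset.mem_sdiff.1 (Finset.mem_of_min hk.symm)
  have hdep := hk'.2
  rw [hmem, not_not] at hdep
  have hdep' := span_image_lt_le_span_pivots (v (ξ + t • η)) k hdep
  set s : Set (Fin m) := {i | i < k ∧ i ∈ B.genericJumpSet} with hs
  have hsub : insert k s ⊆ (B.genericJumpSet : Set (Fin m)) :=
    Set.insert_subset hk'.1 fun i hi => hi.2
  refine ((hlin.mono fun i hi => hi.2 : LinearIndepOn ℝ (v (ξ + t • η)) s).notMem_span_iff.2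
    ⟨hlin.mono hsub, fun h => lt_irrefl k h.1⟩) (Submodule.span_mono (Set.image_mono ?_) hdep')
  rintro i ⟨hi, hmemi⟩
  rw [← hmem] at hmemi
  refine ⟨hi, ?_⟩
  by_contra hne
  have := lt_of_lt_of_le hlt (Finset.min_le (Finset.mem_sdiff.2 ⟨hmemi, hne⟩))
  rw [← hk, WithTop.coe_lt_coe] at this
  exact lt_asymm this hi

end JordanHolderBasis

end JumpSets

/-! ### Radicals on subspaces -/

section RadicalOn

variable {L : Type*} [LieRing L] [LieAlgebra ℝ L]

/-- The radical of the restriction to `W` of the alternating form `(x, y) ↦ ξ [x, y]`. -/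
def radicalOn (W : Submodule ℝ L) (ξ : Module.Dual ℝ L) : Submodule ℝ L where
  carrier := {x | x ∈ W ∧ ∀ y ∈ W, ξ ⁅x, y⁆ = 0}
  add_mem' := fun ha hb => ⟨add_mem ha.1 hb.1, fun y hy => by
    rw [add_lie, map_add, ha.2 y hy, hb.2 y hy, add_zero]⟩
  zero_mem' := ⟨zero_mem _, fun y _ => by rw [zero_lie, map_zero]⟩
  smul_mem' := fun c x hx => ⟨W.smul_mem c hx.1, fun y hy => by
    rw [smul_lie, map_smul, hx.2 y hy, smul_zero]⟩

theorem mem_radicalOn_iff {W : Submodule ℝ L} {ξ : Module.Dual ℝ L} {x : L} :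
    x ∈ radicalOn W ξ ↔ x ∈ W ∧ ∀ y ∈ W, ξ ⁅x, y⁆ = 0 := Iff.rfl

theorem radicalOn_le (W : Submodule ℝ L) (ξ : Module.Dual ℝ L) : radicalOn W ξ ≤ W :=
  fun _ hx => hx.1

theorem radicalOn_top (ξ : Module.Dual ℝ L) : radicalOn ⊤ ξ = isotropy ξ := by
  ext x
  simp [mem_radicalOn_iff, mem_isotropy_iff]

theorem radicalOn_bot (ξ : Module.Dual ℝ L) : radicalOn ⊥ ξ = ⊥ :=
  le_bot_iff.1 (radicalOn_le ⊥ ξ)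

theorem map_isotropy_restrict (I : LieIdeal ℝ L) (ξ : Module.Dual ℝ L) :
    (isotropy (ξ ∘ₗ I.toSubmodule.subtype : Module.Dual ℝ I)).map I.toSubmodule.subtype =
      radicalOn I.toSubmodule ξ := by
  ext x
  constructor
  · rintro ⟨x, hx, rfl⟩
    exact ⟨x.2, fun y hy => hx ⟨y, hy⟩⟩
  · rintro ⟨hx, h⟩
    exact ⟨⟨x, hx⟩, fun y => h y y.2, rfl⟩

theorem map_isotropy_restrict_subalgebra (M : LieSubalgebra ℝ L) (ξ : Module.Dual ℝ L) :
    (isotropy (ξ ∘ₗ M.toSubmodule.subtype : Module.Dual ℝ M)).map M.toSubmodule.subtype =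
      radicalOn M.toSubmodule ξ := by
  ext x
  constructor
  · rintro ⟨x, hx, rfl⟩
    exact ⟨x.2, fun y hy => hx ⟨y, hy⟩⟩
  · rintro ⟨hx, h⟩
    exact ⟨⟨x, hx⟩, fun y => h y y.2, rfl⟩

theorem radicalOn_congr {W : Submodule ℝ L} {ξ ξ' : Module.Dual ℝ L}
    (hW : ∀ x ∈ W, ∀ y ∈ W, ⁅x, y⁆ ∈ W) (h : ∀ x ∈ W, ξ x = ξ' x) :
    radicalOn W ξ = radicalOn W ξ' := by
  ext x
  refine and_congr_right fun hx => forall₂_congr fun y hy => ?_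
  rw [h _ (hW x hx y hy)]

/-- The radical of an orthogonal sum is the sum of the radicals. -/
theorem radicalOn_sup {P Q : Submodule ℝ L} {ξ : Module.Dual ℝ L}
    (h : ∀ x ∈ P, ∀ y ∈ Q, ξ ⁅x, y⁆ = 0) :
    radicalOn (P ⊔ Q) ξ = radicalOn P ξ ⊔ radicalOn Q ξ := by
  have h' : ∀ x ∈ Q, ∀ y ∈ P, ξ ⁅x, y⁆ = 0 := fun x hx y hy => by
    rw [← lie_skew, map_neg, h y hy x hx, neg_zero]
  refine le_antisymm ?_ (sup_le ?_ ?_)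
  · rintro x ⟨hx, hxy⟩
    obtain ⟨a, ha, b, hb, rfl⟩ := Submodule.mem_sup.1 hx
    refine Submodule.add_mem_sup ⟨ha, fun y hy => ?_⟩ ⟨hb, fun y hy => ?_⟩
    · have := hxy y (Submodule.mem_sup_left hy)
      rwa [add_lie, map_add, h' b hb y hy, add_zero] at this
    · have := hxy y (Submodule.mem_sup_right hy)
      rwa [add_lie, map_add, h a ha y hy, zero_add] at this
  · rintro x ⟨hx, hxy⟩
    refine ⟨Submodule.mem_sup_left hx, fun y hy => ?_⟩
    obtain ⟨a, ha, b, hb, rfl⟩ := Submodule.mem_sup.1 hy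
    rw [lie_add, map_add, hxy a ha, h x hx b hb, add_zero]
  · rintro x ⟨hx, hxy⟩
    refine ⟨Submodule.mem_sup_right hx, fun y hy => ?_⟩
    obtain ⟨a, ha, b, hb, rfl⟩ := Submodule.mem_sup.1 hy
    rw [lie_add, map_add, hxy b hb, h' x hx a ha, add_zero]

end RadicalOn

/-! ### The stepwise generic set -/

section StepwiseGeneric

variable {L : Type*} [LieRing L] [LieAlgebra ℝ L] {m : ℕ}

namespace JordanHolderBasis

theorem mem_jumpSet_restrict_iff (B : JordanHolderBasis L m) (k : Fin (m + 1))
    (ξ : Module.Dual ℝ L) (i : Fin (k : ℕ)) :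
    i ∈ (B.restrict k).jumpSet (ξ ∘ₗ (B.ideal k).toSubmodule.subtype) ↔
      B.toBasis (Fin.castLE (Nat.lt_succ_iff.1 k.2) i) ∉
        Submodule.span ℝ (B.toBasis '' {j | (j : ℕ) < (i : ℕ)}) ⊔
          radicalOn (B.ideal k).toSubmodule ξ := by
  have hb : ⇑(B.restrict k).toBasis = B.restrictVec k := Module.Basis.coe_mk _ (B.span_restrictVec k)
  rw [mem_jumpSet_iff, not_iff_not, hb, ← map_isotropy_restrict,
    ← B.map_span_restrictVec k i i.2.le, ← Submodule.map_sup]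
  exact ((Submodule.injective_subtype _).mem_set_image).symm

variable [LieRing.IsNilpotent L]

theorem radicalOn_coadjoint (I : LieIdeal ℝ L) (x : L) (ξ : Module.Dual ℝ L) {r : L}
    (hr : r ∈ radicalOn I.toSubmodule ξ) :
    expAd x r ∈ radicalOn I.toSubmodule (coadjoint x ξ) := by
  have hI : ∀ x, ∀ w ∈ I.toSubmodule, ⁅x, w⁆ ∈ I.toSubmodule := fun x w hw => I.lie_mem hw
  refine ⟨expAd_mem (hI x) hr.1, fun y hy => ?_⟩
  rw [coadjoint_apply, expAd_lie, expAd_neg_expAd]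
  exact hr.2 _ (expAd_mem (hI (-x)) hy)

theorem jumpSet_restrict_coadjoint (B : JordanHolderBasis L m) (k : Fin (m + 1)) (x : L)
    (ξ : Module.Dual ℝ L) :
    (B.restrict k).jumpSet (coadjoint x ξ ∘ₗ (B.ideal k).toSubmodule.subtype) =
      (B.restrict k).jumpSet (ξ ∘ₗ (B.ideal k).toSubmodule.subtype) := by
  have key : ∀ (x : L) (ξ : Module.Dual ℝ L),
      (B.restrict k).jumpSet (coadjoint x ξ ∘ₗ (B.ideal k).toSubmodule.subtype) ⊆
        (B.restrict k).jumpSet (ξ ∘ₗ (B.ideal k).toSubmodule.subtype) := by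
    intro x ξ i hi
    rw [mem_jumpSet_restrict_iff] at hi ⊢
    refine fun hmem => hi ?_
    set j := Fin.castLE (Nat.lt_succ_iff.1 k.2) i with hj
    have hF : ∀ w ∈ Submodule.span ℝ (B.toBasis '' {j | (j : ℕ) < (i : ℕ)}),
        ⁅x, w⁆ ∈ Submodule.span ℝ (B.toBasis '' {j | (j : ℕ) < (i : ℕ)}) :=
      fun w hw => (B.ideal j.castSucc).lie_mem hw
    obtain ⟨u, hu, r, hr, hur⟩ := Submodule.mem_sup.1 hmem
    have e : B.toBasis j = (expAd x u - (expAd x (B.toBasis j) - B.toBasis j)) + expAd x r := by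
      rw [← hur, map_add]; abel
    rw [e]
    exact Submodule.add_mem_sup (sub_mem (expAd_mem hF hu) (expAd_sub_mem hF (B.lie_mem x j)))
      (radicalOn_coadjoint _ x ξ hr)
  refine (key x ξ).antisymm ?_
  have := key (-x) (coadjoint x ξ)
  rwa [coadjoint_neg_coadjoint] at this

end JordanHolderBasis

theorem coadjoint_mem_stepwiseGenericSet [LieRing.IsNilpotent L] {q : ℕ}
    (B : JordanHolderBasis L m) (d : Fin (q + 1) → Fin (m + 1)) (x : L) {ξ : Module.Dual ℝ L}
    (hξ : ξ ∈ stepwiseGenericSet B d) : coadjoint x ξ ∈ stepwiseGenericSet B d := fun j => by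
  rw [B.jumpSet_restrict_coadjoint, hξ j]

/-- Finitely many Zariski open nonempty conditions can be met simultaneously. -/
theorem stepwiseGenericSet_nonempty {q : ℕ} (B : JordanHolderBasis L m)
    (d : Fin (q + 1) → Fin (m + 1)) : (stepwiseGenericSet B d).Nonempty := by
  let ρ : ∀ j : Fin q, Module.Dual ℝ L → Module.Dual ℝ (B.ideal (d j.succ)) :=
    fun j ξ => ξ ∘ₗ (B.ideal (d j.succ)).toSubmodule.subtype
  have key : ∀ s : Finset (Fin q), ∃ ξ : Module.Dual ℝ L, ∀ j ∈ s,
      (B.restrict (d j.succ)).jumpSet (ρ j ξ) = (B.restrict (d j.succ)).genericJumpSet := by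
    intro s
    induction s using Finset.induction_on with
    | empty => exact ⟨0, by simp⟩
    | insert a s _ ih =>
      obtain ⟨ξ, hξ⟩ := ih
      obtain ⟨η₀, hη₀⟩ := (B.restrict (d a.succ)).genericJumpSet_spec.1
      obtain ⟨η, hη⟩ := LinearMap.exists_extend (p := (B.ideal (d a.succ)).toSubmodule) η₀
      have hη' : (B.restrict (d a.succ)).jumpSet (ρ a η) =
          (B.restrict (d a.succ)).genericJumpSet := by
        rw [← hη₀, ← hη]
      have hfin : (({0} ∪ ⋃ j ∈ s, {t : ℝ | (B.restrict (d j.succ)).jumpSet (ρ j ξ + t • ρ j η) ≠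
          (B.restrict (d j.succ)).genericJumpSet}) ∪
          (fun t : ℝ => t⁻¹) ⁻¹' {t : ℝ | (B.restrict (d a.succ)).jumpSet (ρ a η + t • ρ a ξ) ≠
            (B.restrict (d a.succ)).genericJumpSet}).Finite := by
        refine ((Set.finite_singleton _).union (s.finite_toSet.biUnion fun j hj =>
          (B.restrict _).finite_setOf_jumpSet_add_smul_ne (hξ j hj) _)).union ?_
        exact ((B.restrict _).finite_setOf_jumpSet_add_smul_ne hη' _).preimage
          inv_injective.injOn
      obtain ⟨t, ht⟩ := hfin.exists_notMem
      simp only [Set.mem_union, Set.mem_singleton_iff, Set.mem_iUnion, Set.mem_preimage,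
        Set.mem_ofPred_eq, not_or, not_exists, not_not] at ht
      obtain ⟨⟨ht0, hts⟩, hta⟩ := ht
      refine ⟨ξ + t • η, fun j hj => ?_⟩
      rcases Finset.mem_insert.1 hj with rfl | hj
      · have e : ρ j (ξ + t • η) = t • (ρ j η + t⁻¹ • ρ j ξ) := by
          rw [smul_add, smul_smul, mul_inv_cancel₀ ht0, one_smul, add_comm]
          rfl
        rw [e, JordanHolderBasis.jumpSet_smul _ ht0, hta]
      · exact hts j hj
  obtain ⟨ξ, hξ⟩ := key Finset.univ
  exact ⟨ξ, fun j => hξ j (Finset.mem_univ j)⟩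

end StepwiseGeneric

/-! ### Subalgebras with one-dimensional center -/

section Subalgebra

variable {L : Type*} [LieRing L] [LieAlgebra ℝ L]

theorem mem_centerOf_iff {M : LieSubalgebra ℝ L} {x : L} :
    x ∈ centerOf M ↔ x ∈ M ∧ ∀ y ∈ M, ⁅x, y⁆ = 0 := by
  constructor
  · rintro ⟨(x : M), hx, rfl⟩
    refine ⟨x.2, fun y hy => ?_⟩
    exact congrArg Subtype.val ((mem_center_iff_lie_eq_zero (L := M)).1 hx ⟨y, hy⟩)
  · rintro ⟨hx, h⟩
    exact ⟨⟨x, hx⟩, (mem_center_iff_lie_eq_zero (L := M)).2 fun y => Subtype.ext (h y y.2), rfl⟩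

theorem centerOf_le (M : LieSubalgebra ℝ L) : centerOf M ≤ M.toSubmodule :=
  fun _ hx => (mem_centerOf_iff.1 hx).1

theorem centerOf_le_radicalOn (M : LieSubalgebra ℝ L) (ξ : Module.Dual ℝ L) :
    centerOf M ≤ radicalOn M.toSubmodule ξ := fun x hx =>
  ⟨(mem_centerOf_iff.1 hx).1, fun y hy => by rw [(mem_centerOf_iff.1 hx).2 y hy, map_zero]⟩

theorem radicalOn_eq_centerOf_iff {M : LieSubalgebra ℝ L} {ξ : Module.Dual ℝ L} :
    radicalOn M.toSubmodule ξ = centerOf M ↔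
      isotropy (ξ ∘ₗ M.toSubmodule.subtype : Module.Dual ℝ M) =
        (LieAlgebra.center ℝ M).toSubmodule := by
  rw [← map_isotropy_restrict_subalgebra, centerOf]
  exact (Submodule.map_injective_of_injective M.toSubmodule.injective_subtype).eq_iff

theorem isNilpotent_subalgebra [LieRing.IsNilpotent L] (M : LieSubalgebra ℝ L) :
    LieRing.IsNilpotent M :=
  Function.Injective.lieAlgebra_isNilpotent (f := M.incl) Subtype.val_injective

theorem finiteDimensional_subalgebra [FiniteDimensional ℝ L] (M : LieSubalgebra ℝ L) :
    FiniteDimensional ℝ M :=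
  inferInstanceAs (FiniteDimensional ℝ M.toSubmodule)

theorem coe_expAd [LieRing.IsNilpotent L] (M : LieSubalgebra ℝ L) (x y : M) :
    ((expAd x y : M) : L) = expAd (x : L) (y : L) := by
  have := isNilpotent_subalgebra M
  obtain ⟨n₁, h₁⟩ := isNilpotent_ad x
  obtain ⟨n₂, h₂⟩ := isNilpotent_ad (x : L)
  rw [expAd_eq_sum x (k := max n₁ n₂) (pow_eq_zero_of_le (le_max_left _ _) h₁),
    expAd_eq_sum (x : L) (k := max n₁ n₂) (pow_eq_zero_of_le (le_max_right _ _) h₂),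
    LinearMap.sum_apply, LinearMap.sum_apply]
  have hpow : ∀ i, (((LieAlgebra.ad ℝ M x ^ i) y : M) : L) =
      (LieAlgebra.ad ℝ L (x : L) ^ i) (y : L) := by
    intro i
    induction i with
    | zero => rfl
    | succ i ih =>
      rw [pow_succ', pow_succ', Module.End.mul_apply, Module.End.mul_apply, ← ih]
      rfl
  change M.toSubmodule.subtype _ = _
  rw [map_sum]
  refine Finset.sum_congr rfl fun i _ => ?_
  rw [LinearMap.smul_apply, LinearMap.smul_apply, map_smul, ← hpow]
  rfl

/-- For a subalgebra with one-dimensional center and generic flat orbits, the radical of any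
functional not vanishing on the center is the center. -/
theorem radicalOn_eq_centerOf [LieRing.IsNilpotent L] [FiniteDimensional ℝ L]
    {M : LieSubalgebra ℝ L} (hdim : Module.finrank ℝ (centerOf M) = 1)
    (hflat : HasGenericFlatOrbits M) {ξ : Module.Dual ℝ L} {c : L} (hc : c ∈ centerOf M)
    (hξc : ξ c ≠ 0) : radicalOn M.toSubmodule ξ = centerOf M := by
  have := isNilpotent_subalgebra M
  have := finiteDimensional_subalgebra M
  rw [radicalOn_eq_centerOf_iff]
  obtain ⟨c, hc, rfl⟩ := hc
  refine isotropy_eq_center_of_apply_ne_zero ?_ hflat hc hξc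
  rw [← hdim]
  exact (Submodule.equivMapOfInjective _ M.toSubmodule.injective_subtype _).finrank_eq

end Subalgebra

/-! ### Initial suprema of a finite family -/

section PartialSup

variable {α : Type*} [CompleteLattice α] {q : ℕ}

/-- The supremum of the first `k` members of a finite family. -/
def initialSup (f : Fin q → α) (k : Fin (q + 1)) : α := ⨆ i, ⨆ _ : i.castSucc < k, f i

theorem initialSup_le_iff {f : Fin q → α} {k : Fin (q + 1)} {a : α} :
    initialSup f k ≤ a ↔ ∀ i : Fin q, i.castSucc < k → f i ≤ a := by
  simp [initialSup]

theorem le_initialSup {f : Fin q → α} {k : Fin (q + 1)} {i : Fin q} (h : i.castSucc < k) :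
    f i ≤ initialSup f k := initialSup_le_iff.1 le_rfl i h

theorem initialSup_zero (f : Fin q → α) : initialSup f 0 = ⊥ := by
  simp [initialSup]

theorem initialSup_succ (f : Fin q → α) (j : Fin q) :
    initialSup f j.succ = f j ⊔ initialSup f j.castSucc := by
  refine le_antisymm (initialSup_le_iff.2 fun i hi => ?_)
    (sup_le (le_initialSup (Fin.castSucc_lt_succ)) (initialSup_le_iff.2 fun i hi =>
      le_initialSup (hi.trans Fin.castSucc_lt_succ)))
  rcases (Fin.castSucc_lt_succ_iff.1 hi).eq_or_lt with rfl | h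
  · exact le_sup_left
  · exact le_sup_of_le_right (le_initialSup (Fin.castSucc_lt_castSucc_iff.2 h))

theorem initialSup_castSucc (f : Fin q → α) (j : Fin q) :
    initialSup f j.castSucc = ⨆ i, ⨆ _ : i < j, f i := by
  simp only [initialSup, Fin.castSucc_lt_castSucc_iff]

theorem initialSup_last (f : Fin q → α) : initialSup f (Fin.last q) = ⨆ i, f i := by
  simp [initialSup, Fin.castSucc_lt_last]

theorem initialSup_mono (f : Fin q → α) : Monotone (initialSup f) := fun _ _ hkl =>
  initialSup_le_iff.2 fun _ hi => le_initialSup (hi.trans_le hkl)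

theorem initialSup_congr {f g : Fin q → α} {k : Fin (q + 1)}
    (h : ∀ i : Fin q, i.castSucc < k → f i = g i) : initialSup f k = initialSup g k :=
  iSup_congr fun i => iSup_congr fun hi => h i hi

end PartialSup

/-! ### Towers with flat blocks -/

/-- A tower `0 = N 0 ≤ N 1 ≤ ⋯ ≤ N q = L` of ideals with `N (j + 1) = M j ⋉ N j`, where each `M j`
is the sum of its one-dimensional center and `V j` and has generic flat coadjoint orbits,
`[M j, N j]` lies in the sum of the `V i` with `i < j`, and `M j` commutes with the centers of the
`M i` with `i < j`. -/
structure IsFlatTower {L : Type*} [LieRing L] [LieAlgebra ℝ L] {q : ℕ}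
    (N : Fin (q + 1) → LieIdeal ℝ L) (M : Fin q → LieSubalgebra ℝ L)
    (V : Fin q → Submodule ℝ L) : Prop where
  bot : (N 0).toSubmodule = ⊥
  top : (N (Fin.last q)).toSubmodule = ⊤
  disjoint : ∀ j, Disjoint (M j).toSubmodule (N j.castSucc).toSubmodule
  sup_eq : ∀ j, (M j).toSubmodule ⊔ (N j.castSucc).toSubmodule = (N j.succ).toSubmodule
  finrank_center : ∀ j, Module.finrank ℝ (centerOf (M j)) = 1
  center_disjoint : ∀ j, Disjoint (centerOf (M j)) (V j)
  center_sup : ∀ j, centerOf (M j) ⊔ V j = (M j).toSubmodule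
  flat : ∀ j, HasGenericFlatOrbits (M j)
  lie_mem : ∀ j, ∀ x ∈ M j, ∀ y ∈ N j.castSucc, ⁅x, y⁆ ∈ initialSup V j.castSucc
  lie_center : ∀ j, ∀ x ∈ M j, ∀ y ∈ initialSup (fun i => centerOf (M i)) j.castSucc, ⁅x, y⁆ = 0

namespace IsFlatTower

variable {L : Type*} [LieRing L] [LieAlgebra ℝ L] {q : ℕ} {N : Fin (q + 1) → LieIdeal ℝ L}
  {M : Fin q → LieSubalgebra ℝ L} {V : Fin q → Submodule ℝ L}

theorem eq_initialSup (h : IsFlatTower N M V) (k : Fin (q + 1)) :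
    (N k).toSubmodule = initialSup (fun i => (M i).toSubmodule) k := by
  induction k using Fin.induction with
  | zero => rw [h.bot, initialSup_zero]
  | succ j ih => rw [← h.sup_eq, initialSup_succ, ih]

theorem mono (h : IsFlatTower N M V) {k l : Fin (q + 1)} (hkl : k ≤ l) :
    (N k).toSubmodule ≤ (N l).toSubmodule := by
  rw [h.eq_initialSup, h.eq_initialSup]
  exact initialSup_mono _ hkl

theorem subalgebra_le (h : IsFlatTower N M V) {i : Fin q} {k : Fin (q + 1)} (hik : i.castSucc < k) :
    (M i).toSubmodule ≤ (N k).toSubmodule := by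
  rw [h.eq_initialSup]
  exact le_initialSup (f := fun i => (M i).toSubmodule) hik

theorem le_subalgebra (h : IsFlatTower N M V) (i : Fin q) : V i ≤ (M i).toSubmodule := by
  rw [← h.center_sup]; exact le_sup_right

theorem initialSup_le (h : IsFlatTower N M V) (k : Fin (q + 1)) :
    initialSup V k ≤ (N k).toSubmodule :=
  initialSup_le_iff.2 fun i hi => (h.le_subalgebra i).trans (h.subalgebra_le hi)

theorem initialSup_center_le (h : IsFlatTower N M V) (k : Fin (q + 1)) :
    initialSup (fun i => centerOf (M i)) k ≤ (N k).toSubmodule :=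
  initialSup_le_iff.2 fun i hi => (centerOf_le (M i)).trans (h.subalgebra_le hi)

theorem exists_center_generator (h : IsFlatTower N M V) (j : Fin q) :
    ∃ c ∈ centerOf (M j), c ≠ 0 ∧ ∀ y ∈ centerOf (M j), ∃ t : ℝ, y = t • c := by
  obtain ⟨c, hc, hspan⟩ := finrank_eq_one_iff'.1 (h.finrank_center j)
  refine ⟨c, c.2, fun h0 => hc (Subtype.ext h0), fun y hy => ?_⟩
  obtain ⟨t, ht⟩ := hspan ⟨y, hy⟩
  exact ⟨t, (congrArg Subtype.val ht).symm⟩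

theorem mem_center_of_mem_sup (h : IsFlatTower N M V) {j : Fin q} {Q : Submodule ℝ L}
    (hQ : Q ≤ (N j.castSucc).toSubmodule) {x : L} (hx : x ∈ M j)
    (hxs : x ∈ centerOf (M j) ⊔ Q) : x ∈ centerOf (M j) := by
  obtain ⟨z, hz, s, hs, rfl⟩ := Submodule.mem_sup.1 hxs
  have hs' : s ∈ (M j).toSubmodule := by
    have := sub_mem hx (centerOf_le _ hz)
    rwa [add_sub_cancel_left] at this
  rw [Submodule.disjoint_def.1 (h.disjoint j) s hs' (hQ hs), add_zero]
  exact hz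

theorem radicalOn_succ (h : IsFlatTower N M V) {ξ : Module.Dual ℝ L} {j : Fin q}
    (hξ : initialSup V j.castSucc ≤ LinearMap.ker ξ) :
    radicalOn (N j.succ).toSubmodule ξ =
      radicalOn (M j).toSubmodule ξ ⊔ radicalOn (N j.castSucc).toSubmodule ξ := by
  rw [← h.sup_eq, radicalOn_sup fun x hx y hy => hξ (h.lie_mem j x hx y hy)]

theorem radicalOn_eq (h : IsFlatTower N M V) {ξ : Module.Dual ℝ L} {k : Fin (q + 1)}
    (hξ : initialSup V k ≤ LinearMap.ker ξ) :
    radicalOn (N k).toSubmodule ξ = initialSup (fun i => radicalOn (M i).toSubmodule ξ) k := by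
  induction k using Fin.induction with
  | zero => rw [h.bot, radicalOn_bot, initialSup_zero]
  | succ j ih =>
    have hξ' := (initialSup_mono V Fin.castSucc_lt_succ.le).trans hξ
    rw [h.radicalOn_succ hξ', ih hξ', initialSup_succ]

/-- The sum of the centers meets the ideal `N k` in the sum of the first `k` centers. -/
theorem mem_initialSup_center (h : IsFlatTower N M V) (k : Fin (q + 1)) {x : L}
    (hx : x ∈ ⨆ i, centerOf (M i)) (hxN : x ∈ N k) :
    x ∈ initialSup (fun i => centerOf (M i)) k := by
  induction k using Fin.reverseInduction with
  | last => rwa [initialSup_last]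
  | cast j ih =>
    have hx' := ih (h.mono Fin.castSucc_lt_succ.le hxN)
    rw [initialSup_succ] at hx'
    obtain ⟨z, hz, s, hs, rfl⟩ := Submodule.mem_sup.1 hx'
    have hz' : z ∈ (N j.castSucc).toSubmodule := by
      have := sub_mem hxN (h.initialSup_center_le _ hs)
      rwa [add_sub_cancel_right] at this
    rw [Submodule.disjoint_def.1 (h.disjoint j) z (centerOf_le _ hz) hz', zero_add]
    exact hs

theorem radicalOn_eq_centerOf_of_isotropy_eq (h : IsFlatTower N M V) {ξ : Module.Dual ℝ L}
    (hξ : (⨆ i, V i) ≤ LinearMap.ker ξ) (hiso : isotropy ξ = ⨆ i, centerOf (M i)) (j : Fin q) :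
    radicalOn (M j).toSubmodule ξ = centerOf (M j) := by
  refine le_antisymm (fun x hx => ?_) (centerOf_le_radicalOn _ _)
  rw [← initialSup_last] at hξ
  have hx' : x ∈ isotropy ξ := by
    rw [← radicalOn_top, ← h.top, h.radicalOn_eq hξ]
    exact le_initialSup (f := fun i => radicalOn (M i).toSubmodule ξ) (Fin.castSucc_lt_last j) hx
  rw [hiso] at hx'
  have := h.mem_initialSup_center j.succ hx' (h.subalgebra_le Fin.castSucc_lt_succ hx.1)
  rw [initialSup_succ] at this
  exact h.mem_center_of_mem_sup (h.initialSup_center_le _) hx.1 this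

theorem radicalOn_eq_of_blocks (h : IsFlatTower N M V) {ξ : Module.Dual ℝ L}
    (hξ : (⨆ i, V i) ≤ LinearMap.ker ξ)
    (hblocks : ∀ i, radicalOn (M i).toSubmodule ξ = centerOf (M i)) (k : Fin (q + 1)) :
    radicalOn (N k).toSubmodule ξ = initialSup (fun i => centerOf (M i)) k := by
  rw [← initialSup_last] at hξ
  rw [h.radicalOn_eq ((initialSup_mono V (Fin.le_last k)).trans hξ)]
  exact initialSup_congr fun i _ => hblocks i

theorem isotropy_eq_of_blocks (h : IsFlatTower N M V) {ξ : Module.Dual ℝ L}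
    (hξ : (⨆ i, V i) ≤ LinearMap.ker ξ)
    (hblocks : ∀ i, radicalOn (M i).toSubmodule ξ = centerOf (M i)) :
    isotropy ξ = ⨆ i, centerOf (M i) := by
  rw [← radicalOn_top, ← h.top, h.radicalOn_eq_of_blocks hξ hblocks, initialSup_last]

variable [LieRing.IsNilpotent L]

/-- A coadjoint orbit contains at most one functional in normal form. An element moving one normal
form to another lies, modulo the stabilizer, in the span of the later blocks, and these commute
with the center of `M j`. -/
theorem coadjoint_eq_of_normal_form (h : IsFlatTower N M V) {ξ : Module.Dual ℝ L} {z : L}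
    (hξ : (⨆ i, V i) ≤ LinearMap.ker ξ)
    (hblocks : ∀ i, radicalOn (M i).toSubmodule ξ = centerOf (M i))
    (hξ' : (⨆ i, V i) ≤ LinearMap.ker (coadjoint z ξ)) : coadjoint z ξ = ξ := by
  have key : ∀ k : Fin (q + 1), ∀ y ∈ (N k).toSubmodule, coadjoint z ξ y = ξ y := by
    intro k
    induction k using Fin.induction with
    | zero =>
      intro y hy
      rw [h.bot, Submodule.mem_bot] at hy
      rw [hy, map_zero, map_zero]
    | succ j ih =>
      intro y hy
      rw [← h.sup_eq, ← h.center_sup] at hy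
      obtain ⟨a, ha, b, hb, rfl⟩ := Submodule.mem_sup.1 hy
      obtain ⟨c, hc, v, hv, rfl⟩ := Submodule.mem_sup.1 ha
      have hv₁ : ξ v = 0 := hξ (le_iSup V j hv)
      have hv₂ : coadjoint z ξ v = 0 := hξ' (le_iSup V j hv)
      suffices hzc : ⁅z, c⁆ = 0 by
        have : coadjoint z ξ c = ξ c := by
          rw [coadjoint_apply, expAd_eq_self (by rw [neg_lie, hzc, neg_zero])]
        rw [map_add, map_add, map_add, map_add, hv₁, hv₂, this, ih b hb]
      have hstab : ∀ y ∈ (N j.castSucc).toSubmodule, ξ ⁅z, y⁆ = 0 := by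
        intro y hy
        have := apply_lie_eq_zero_of_apply_expAd (x := -z) (ξ := ξ)
          (fun w hw => (N j.castSucc).lie_mem hw) ih y hy
        rwa [neg_lie, map_neg, neg_eq_zero] at this
      set P : Submodule ℝ L := ⨆ i, ⨆ _ : j ≤ i, (M i).toSubmodule with hP
      have hz : z ∈ (N j.castSucc).toSubmodule ⊔ P := by
        have htop : z ∈ (N (Fin.last q)).toSubmodule := by rw [h.top]; trivial
        rw [h.eq_initialSup] at htop
        suffices hle : initialSup (fun i => (M i).toSubmodule) (Fin.last q) ≤
            (N j.castSucc).toSubmodule ⊔ P from hle htop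
        refine initialSup_le_iff.2 fun i _ => ?_
        rcases lt_or_ge i j with hij | hij
        · exact le_sup_of_le_left (h.subalgebra_le (Fin.castSucc_lt_castSucc_iff.2 hij))
        · exact le_sup_of_le_right (le_iSup₂_of_le i hij le_rfl)
      obtain ⟨z₀, hz₀, z₁, hz₁, rfl⟩ := Submodule.mem_sup.1 hz
      have hz₁c : ⁅z₁, c⁆ = 0 := by
        have hle : P ≤ LinearMap.ker (LieAlgebra.ad ℝ L c) := iSup₂_le fun i hi x hx => by
          rw [LinearMap.mem_ker, LieAlgebra.ad_apply, ← lie_skew, neg_eq_zero]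
          rcases hi.eq_or_lt with rfl | hlt
          · rw [← lie_skew, (mem_centerOf_iff.1 hc).2 x hx, neg_zero]
          · exact h.lie_center i x hx c (le_initialSup (f := fun i => centerOf (M i))
              (Fin.castSucc_lt_castSucc_iff.2 hlt) hc)
        have := hle hz₁
        rwa [LinearMap.mem_ker, LieAlgebra.ad_apply, ← lie_skew, neg_eq_zero] at this
      have hz₁N : ∀ y ∈ (N j.castSucc).toSubmodule, ξ ⁅z₁, y⁆ = 0 := by
        intro y hy
        have hle : P ≤ LinearMap.ker (ξ ∘ₗ LieAlgebra.ad ℝ L y) := iSup₂_le fun i hi x hx => by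
          rw [LinearMap.mem_ker, LinearMap.comp_apply, LieAlgebra.ad_apply, ← lie_skew, map_neg,
            neg_eq_zero]
          have hmem := h.lie_mem i x hx y (h.mono (Fin.castSucc_le_castSucc_iff.2 hi) hy)
          rw [← initialSup_last] at hξ
          exact hξ (initialSup_mono V (Fin.le_last _) hmem)
        have := hle hz₁
        rwa [LinearMap.mem_ker, LinearMap.comp_apply, LieAlgebra.ad_apply, ← lie_skew, map_neg,
          neg_eq_zero] at this
      have hz₀rad : z₀ ∈ radicalOn (N j.castSucc).toSubmodule ξ := ⟨hz₀, fun y hy => by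
        have := hstab y hy
        rwa [add_lie, map_add, hz₁N y hy, add_zero] at this⟩
      rw [h.radicalOn_eq_of_blocks hξ hblocks] at hz₀rad
      rw [add_lie, hz₁c, add_zero, ← lie_skew, h.lie_center j c (centerOf_le _ hc) z₀ hz₀rad,
        neg_zero]
  ext y
  exact key (Fin.last q) y (by rw [h.top]; trivial)

variable [FiniteDimensional ℝ L]

/-- If the block `M j` of the form of `η` is degenerate modulo the center of `M j`, then `η` can be
modified on that center alone so as to shrink the radical on `N (j + 1)`. -/
theorem exists_radicalOn_lt (h : IsFlatTower N M V) {η : Module.Dual ℝ L} {j : Fin q}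
    (hη : initialSup V j.castSucc ≤ LinearMap.ker η)
    (hbad : radicalOn (M j).toSubmodule η ≠ centerOf (M j)) :
    ∃ η' : Module.Dual ℝ L,
      radicalOn (N j.succ).toSubmodule η' < radicalOn (N j.succ).toSubmodule η := by
  obtain ⟨c, hc, hc0, -⟩ := h.exists_center_generator j
  have hηc : η c = 0 := by
    by_contra hne
    exact hbad (radicalOn_eq_centerOf (h.finrank_center j) (h.flat j) hc hne)
  have hcN : c ∉ (N j.castSucc).toSubmodule ⊔ V j := by
    intro hmem
    obtain ⟨n, hn, v, hv, hnv⟩ := Submodule.mem_sup.1 hmem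
    have hn' : n ∈ (M j).toSubmodule := by
      have := sub_mem (centerOf_le _ hc) (h.le_subalgebra j hv)
      rwa [← hnv, add_sub_cancel_right] at this
    rw [Submodule.disjoint_def.1 (h.disjoint j) n hn' hn, zero_add] at hnv
    subst hnv
    exact hc0 (Submodule.disjoint_def.1 (h.center_disjoint j) _ hc hv)
  obtain ⟨ζ, hζc, hζ⟩ := Submodule.exists_le_ker_of_notMem hcN
  have hagree : ∀ x ∈ (N j.castSucc).toSubmodule, (η + ζ) x = η x := fun x hx => by
    have : ζ x = 0 := hζ (Submodule.mem_sup_left hx)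
    rw [LinearMap.add_apply, this, add_zero]
  have hη' : initialSup V j.castSucc ≤ LinearMap.ker (η + ζ) := fun x hx => by
    rw [LinearMap.mem_ker, hagree x (h.initialSup_le _ hx)]
    exact hη hx
  have hgood : radicalOn (M j).toSubmodule (η + ζ) = centerOf (M j) :=
    radicalOn_eq_centerOf (h.finrank_center j) (h.flat j) hc (by
      rwa [LinearMap.add_apply, hηc, zero_add])
  refine ⟨η + ζ, ?_⟩
  rw [h.radicalOn_succ hη', h.radicalOn_succ hη, hgood,
    radicalOn_congr (fun x _ y hy => (N j.castSucc).lie_mem hy) hagree]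
  refine lt_of_le_not_ge (sup_le_sup_right (centerOf_le_radicalOn _ _) _) fun hle => hbad ?_
  refine le_antisymm (fun x hx => ?_) (centerOf_le_radicalOn _ _)
  exact h.mem_center_of_mem_sup (radicalOn_le _ _) hx.1 (hle (Submodule.mem_sup_left hx))

/-- If the block `M j` of the form of `η` has the center of `M j` as its radical, the coadjoint
action of `M j` moves `η` to a functional vanishing on `V j`, without changing it on `N j`. -/
theorem exists_coadjoint_vanishing (h : IsFlatTower N M V) {η : Module.Dual ℝ L} {j : Fin q}
    (hη : initialSup V j.castSucc ≤ LinearMap.ker η)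
    (hgood : radicalOn (M j).toSubmodule η = centerOf (M j)) :
    ∃ x : L, (∀ y ∈ N j.castSucc, coadjoint x η y = η y) ∧ V j ≤ LinearMap.ker (coadjoint x η) ∧
      radicalOn (M j).toSubmodule (coadjoint x η) = centerOf (M j) := by
  have := isNilpotent_subalgebra (M j)
  have := finiteDimensional_subalgebra (M j)
  obtain ⟨c, hc, hc0, hspan⟩ := h.exists_center_generator j
  have hcV : c ∉ V j := fun hv => hc0 (Submodule.disjoint_def.1 (h.center_disjoint j) _ hc hv)
  obtain ⟨τ, hτc, hτ⟩ := Submodule.exists_le_ker_of_notMem hcV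
  -- The target functional on `M j`: it agrees with `η` on the center and vanishes on `V j`.
  set σ : Module.Dual ℝ L := (η c / τ c) • τ with hσ
  rw [radicalOn_eq_centerOf_iff] at hgood
  obtain ⟨x, hx⟩ := exists_coadjoint_eq_add hgood
    (ζ := ((σ - η) ∘ₗ (M j).toSubmodule.subtype : Module.Dual ℝ (M j))) (fun y hy => by
      obtain ⟨t, ht⟩ := hspan y ⟨y, hy, rfl⟩
      change (σ - η) (y : L) = 0
      rw [ht]
      simp [hσ, hτc])
  have hrestrict : (coadjoint (x : L) η ∘ₗ (M j).toSubmodule.subtype : Module.Dual ℝ (M j)) =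
      coadjoint x (η ∘ₗ (M j).toSubmodule.subtype : Module.Dual ℝ (M j)) := by
    ext y
    have := coe_expAd (M j) (-x) y
    change η (expAd (-(x : L)) (y : L)) = η ((expAd (-x) y : M j) : L)
    rw [this]
    rfl
  refine ⟨x, fun y hy => ?_, fun v hv => ?_, ?_⟩
  · have hmem := expAd_sub_mem (W := initialSup V j.castSucc) (x := -(x : L)) (y := y)
      (fun w hw => h.lie_mem j _ (neg_mem x.2) w (h.initialSup_le _ hw))
      (h.lie_mem j _ (neg_mem x.2) y hy)
    have := hη hmem
    rw [LinearMap.mem_ker, map_sub, sub_eq_zero] at this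
    exact this
  · have hvM : v ∈ M j := h.le_subalgebra j hv
    have e := LinearMap.congr_fun (hrestrict.trans hx) ⟨v, hvM⟩
    have e' : coadjoint (x : L) η v = η v + (σ v - η v) := e
    have hτv : τ v = 0 := hτ hv
    rw [LinearMap.mem_ker, e', hσ, LinearMap.smul_apply, hτv, smul_zero]
    ring
  · rw [radicalOn_eq_centerOf_iff, hrestrict]
    exact isotropy_coadjoint_eq_center hgood x

/-- **Normal form**: a coadjoint orbit along which the radicals on the ideals `N j` are all minimal
contains a functional vanishing on every `V j`, whose radical on every `M j` is the center. -/
theorem exists_normal_form (h : IsFlatTower N M V) {ξ : Module.Dual ℝ L}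
    (hmin : ∀ (x : L) (j : Fin q) (η' : Module.Dual ℝ L),
      ¬ radicalOn (N j.succ).toSubmodule η' < radicalOn (N j.succ).toSubmodule (coadjoint x ξ)) :
    ∃ x : L, (⨆ i, V i) ≤ LinearMap.ker (coadjoint x ξ) ∧
      ∀ i, radicalOn (M i).toSubmodule (coadjoint x ξ) = centerOf (M i) := by
  have key : ∀ k : Fin (q + 1), ∃ x : L, initialSup V k ≤ LinearMap.ker (coadjoint x ξ) ∧
      ∀ i : Fin q, i.castSucc < k →
        radicalOn (M i).toSubmodule (coadjoint x ξ) = centerOf (M i) := by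
    intro k
    induction k using Fin.induction with
    | zero => exact ⟨0, by simp [initialSup_zero], fun i hi => absurd hi (Fin.not_lt_zero _)⟩
    | succ j ih =>
      obtain ⟨x, hx, hblocks⟩ := ih
      have hgood : radicalOn (M j).toSubmodule (coadjoint x ξ) = centerOf (M j) := by
        by_contra hbad
        obtain ⟨η', hη'⟩ := h.exists_radicalOn_lt hx hbad
        exact hmin x j η' hη'
      obtain ⟨y, hy, hyV, hyM⟩ := h.exists_coadjoint_vanishing hx hgood
      obtain ⟨z, hz⟩ := exists_coadjoint_coadjoint y x ξ
      refine ⟨z, ?_, fun i hi => ?_⟩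
      · rw [hz, initialSup_succ]
        refine sup_le hyV fun v hv => ?_
        rw [LinearMap.mem_ker, hy v (h.initialSup_le _ hv)]
        exact hx hv
      · rw [hz]
        rcases (Fin.castSucc_lt_succ_iff.1 hi).eq_or_lt with rfl | hij
        · exact hyM
        · have hij' := Fin.castSucc_lt_castSucc_iff.2 hij
          rw [← hblocks i hij']
          exact radicalOn_congr (fun u hu v hv => (M i).lie_mem hu hv)
            fun u hu => hy u (h.subalgebra_le hij' hu)
  obtain ⟨x, hx, hblocks⟩ := key (Fin.last q)
  rw [initialSup_last] at hx
  exact ⟨x, hx, fun i => hblocks i (Fin.castSucc_lt_last i)⟩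

end IsFlatTower

/-! ### Generic functionals and their normal forms -/

section MinimalRadicals

variable {L : Type*} [LieRing L] [LieAlgebra ℝ L] {m q : ℕ}

theorem jumpSet_restrict_congr (B : JordanHolderBasis L m) (k : Fin (m + 1))
    {ξ η : Module.Dual ℝ L}
    (h : radicalOn (B.ideal k).toSubmodule ξ = radicalOn (B.ideal k).toSubmodule η) :
    (B.restrict k).jumpSet (ξ ∘ₗ (B.ideal k).toSubmodule.subtype) =
      (B.restrict k).jumpSet (η ∘ₗ (B.ideal k).toSubmodule.subtype) := by
  ext i
  rw [B.mem_jumpSet_restrict_iff, B.mem_jumpSet_restrict_iff, h]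

/-- On the stepwise generic set, the radicals on the ideals of the tower are minimal. -/
theorem not_radicalOn_lt_of_mem_stepwiseGenericSet (B : JordanHolderBasis L m)
    (d : Fin (q + 1) → Fin (m + 1)) {ξ : Module.Dual ℝ L} (hξ : ξ ∈ stepwiseGenericSet B d)
    (j : Fin q) (η : Module.Dual ℝ L) :
    ¬ radicalOn (B.ideal (d j.succ)).toSubmodule η <
      radicalOn (B.ideal (d j.succ)).toSubmodule ξ := by
  intro hlt
  rw [← map_isotropy_restrict, ← map_isotropy_restrict] at hlt
  have hmono : ∀ {p p' : Submodule ℝ (B.ideal (d j.succ)).toSubmodule},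
      p.map (B.ideal (d j.succ)).toSubmodule.subtype ≤
        p'.map (B.ideal (d j.succ)).toSubmodule.subtype → p ≤ p' := fun h =>
    (Submodule.map_le_map_iff_of_injective (Submodule.injective_subtype _) _ _).1 h
  refine (B.restrict (d j.succ)).jumpSet_ne_genericJumpSet
    (lt_of_le_of_ne (hmono hlt.le) fun h => hlt.ne ?_) (hξ j)
  rw [h]

end MinimalRadicals

theorem theorem2p6 {L : Type*} [LieRing L] [LieAlgebra ℝ L] [LieRing.IsNilpotent L]
    {m q : ℕ} (B : JordanHolderBasis L m)
    (d : Fin (q + 1) → Fin (m + 1)) (hd : Monotone d)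
    (hd_zero : d 0 = 0) (hd_last : d (Fin.last q) = Fin.last m)
    (M : Fin q → LieSubalgebra ℝ L) (V : Fin q → Submodule ℝ L)
    (hV_compat : ∀ j, B.Compatible (V j))
    (h_center : ∀ j, Module.finrank ℝ (centerOf (M j)) = 1)
    (h_disj : ∀ j, Disjoint (centerOf (M j)) (V j))
    (h_sup : ∀ j, centerOf (M j) ⊔ V j = (M j).toSubmodule)
    (h_flat : ∀ j, HasGenericFlatOrbits (M j))
    (h_semi : ∀ j : Fin q,
      IsSemidirect ((B.ideal (d j.succ)).toLieSubalgebra ℝ L) (M j)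
        ((B.ideal (d j.castSucc)).toLieSubalgebra ℝ L))
    (h_lie_V : ∀ j : Fin q, ∀ x ∈ M j, ∀ y ∈ B.ideal (d j.castSucc),
      ⁅x, y⁆ ∈ ⨆ i, ⨆ _ : i < j, V i)
    (h_lie_center : ∀ j : Fin q, ∀ x ∈ M j, ∀ y ∈ ⨆ i, ⨆ _ : i < j, centerOf (M i),
      ⁅x, y⁆ = 0) :
    (∀ x : L, ∀ ξ ∈ stepwiseGenericSet B d, coadjoint x ξ ∈ stepwiseGenericSet B d) ∧
    (∀ ξ₀ : Module.Dual ℝ L,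
      (coadjointOrbit ξ₀ ⊆ stepwiseGenericSet B d ↔
        ∃ ξ ∈ coadjointOrbit ξ₀,
          isotropy ξ = (⨆ j, centerOf (M j)) ∧ (⨆ j, V j) ≤ LinearMap.ker ξ) ∧
      (coadjointOrbit ξ₀ ⊆ stepwiseGenericSet B d →
        ∃! ξ, ξ ∈ coadjointOrbit ξ₀ ∧
          isotropy ξ = (⨆ j, centerOf (M j)) ∧ (⨆ j, V j) ≤ LinearMap.ker ξ)) := by
  have : FiniteDimensional ℝ L := Module.Finite.of_basis B.toBasis
  have htower : IsFlatTower (fun k => B.ideal (d k)) M V :=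
    { bot := by
        rw [hd_zero]
        change Submodule.span ℝ (B.toBasis '' {i | (i : ℕ) < ((0 : Fin (m + 1)) : ℕ)}) = ⊥
        simp
      top := by
        rw [hd_last]
        change Submodule.span ℝ (B.toBasis '' {i | (i : ℕ) < ((Fin.last m : Fin (m + 1)) : ℕ)}) = ⊤
        have hset : {i : Fin m | (i : ℕ) < ((Fin.last m : Fin (m + 1)) : ℕ)} = Set.univ := by
          ext i; simp
        rw [hset, Set.image_univ, B.toBasis.span_eq]
      disjoint := fun j => (h_semi j).disjoint
      sup_eq := fun j => (h_semi j).sup_eq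
      finrank_center := h_center
      center_disjoint := h_disj
      center_sup := h_sup
      flat := h_flat
      lie_mem := fun j x hx y hy => by
        rw [initialSup_castSucc]; exact h_lie_V j x hx y hy
      lie_center := fun j x hx y hy => by
        rw [initialSup_castSucc] at hy; exact h_lie_center j x hx y hy }
  have hinv : ∀ x : L, ∀ ξ ∈ stepwiseGenericSet B d, coadjoint x ξ ∈ stepwiseGenericSet B d :=
    fun x ξ hξ => coadjoint_mem_stepwiseGenericSet B d x hξ
  have hnormal : ∀ ξ ∈ stepwiseGenericSet B d, ∃ x : L,
      (⨆ i, V i) ≤ LinearMap.ker (coadjoint x ξ) ∧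
        ∀ i, radicalOn (M i).toSubmodule (coadjoint x ξ) = centerOf (M i) := fun ξ hξ =>
    htower.exists_normal_form fun x j η =>
      not_radicalOn_lt_of_mem_stepwiseGenericSet B d (hinv x ξ hξ) j η
  have hexists : ∀ ξ₀, coadjointOrbit ξ₀ ⊆ stepwiseGenericSet B d →
      ∃ ξ ∈ coadjointOrbit ξ₀,
        isotropy ξ = (⨆ j, centerOf (M j)) ∧ (⨆ j, V j) ≤ LinearMap.ker ξ := by
    intro ξ₀ h
    obtain ⟨x, hx, hblocks⟩ := hnormal ξ₀ (h ⟨0, coadjoint_zero ξ₀⟩)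
    exact ⟨_, ⟨x, rfl⟩, htower.isotropy_eq_of_blocks hx hblocks, hx⟩
  refine ⟨hinv, fun ξ₀ => ⟨⟨hexists ξ₀, ?_⟩, fun h => ?_⟩⟩
  · -- A functional in normal form has the same radicals, hence the same jump sets, as the normal
    -- form of some element of the stepwise generic set, which is nonempty.
    rintro ⟨_, ⟨x, rfl⟩, hiso, hker⟩
    have hblocks := htower.radicalOn_eq_centerOf_of_isotropy_eq hker hiso
    obtain ⟨η, hη⟩ := stepwiseGenericSet_nonempty B d
    obtain ⟨y, hy, hyblocks⟩ := hnormal η hη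
    have hmem : coadjoint x ξ₀ ∈ stepwiseGenericSet B d := fun j => by
      rw [← hinv y η hη j]
      refine jumpSet_restrict_congr B _ ?_
      rw [htower.radicalOn_eq_of_blocks hker hblocks j.succ,
        htower.radicalOn_eq_of_blocks hy hyblocks j.succ]
    have hξ₀ := hinv (-x) _ hmem
    rw [coadjoint_neg_coadjoint] at hξ₀
    rintro _ ⟨z, rfl⟩
    exact hinv z _ hξ₀
  · obtain ⟨_, ⟨x, rfl⟩, hiso, hker⟩ := hexists ξ₀ h
    refine ⟨coadjoint x ξ₀, ⟨⟨x, rfl⟩, hiso, hker⟩, ?_⟩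
    rintro _ ⟨⟨y, rfl⟩, -, hker'⟩
    -- Both functionals lie in the orbit of the first one.
    obtain ⟨z, hz⟩ := exists_coadjoint_coadjoint y (-x) (coadjoint x ξ₀)
    rw [coadjoint_neg_coadjoint] at hz
    change coadjoint y ξ₀ = coadjoint x ξ₀
    have hker'' : (⨆ j, V j) ≤ LinearMap.ker (coadjoint y ξ₀) := hker'
    rw [← hz] at hker'' ⊢
    exact htower.coadjoint_eq_of_normal_form hker
      (htower.radicalOn_eq_centerOf_of_isotropy_eq hker hiso) hker''
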